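/- **Theorem.** Let $\mathbb K=\mathbb R$ or $\mathbb C$, let $m(\mu)=m_1\mu+m_0\in\mathbb K[\mu]$ with $m_1\neq 0$, let $\lambda\in\mathbb K\cup\{\infty\}$, and consider the 1-component BKM system with these data. For $v=(v_1,\dots,v_d)$ let $\sigma_v(\mu)=\mu^d+v_1\mu^{d-1}+\dots+v_d$ be the characteristic polynomial of the companion matrix that has first column $-v$, ones directly above the diagonal and zeros elsewhere. For $N\ge1$ and a monic polynomial $c(\mu)=\mu^{2N+1}+\sum_{i=2}^{2N+1}c_i\mu^{2N+1-i}$ over $\mathbb K$ let $H_i=K_i+V_i$ $(i=1,\dots,N)$ be the Hamiltonians in the variables $(w,p)\in\mathbb K^{2N}$ given by $$\tfrac12\, g^{-1}\big(\det(\mu\,\mathrm{Id}-M)(M^{T}-\mu\,\mathrm{Id})^{-1}p,\,p\big)=\sum_{i=1}^N K_i\,\mu^{N-i},\qquad c(M)\,m(M)^{-1}=\sum_{i=1}^N V_i\,M^{N-i},$$ where $M=M(w)$ is the companion matrix of $w$ and $g^{-1}=g^{-1}(w)$ is the $N\times N$ matrix with entries $(g^{-1})_{ij}=w_{i+j-N-1}$,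 with $w_0=1$ and $w_s=0$ for $s<0$. A *finite-gap solution* (its $x$-profile near $x=0$) is a function $u=\mathcal R(w)$, for some such $N$ and $c$, where $(w(x),p(x))$ is a solution near $x=0$ of $$ (w_i)_x=\frac{\partial H_1}{\partial p_i},\qquad (p_i)_x=-\frac{\partial H_1}{\partial w_i}$$ with $m(M(w(x)))$ invertible and with initial condition $(w(0),p(0))$ on the common level set $\{H_1=\dots=H_N=0\}$, and the finite-reduction map $w\mapsto u=\mathcal R(w)$ is determined by the condition that $\sigma_u(\mu)\,\sigma_w(\mu)^2-c(\mu)$ is divisible by $m(\mu)$ with quotient of degree at most $2N-1$; if $\lambda\ne\infty$, it is also required that $c(\lambda)$ has a nonzero square root in $\mathbb K$ (the factor by which the time variable is scaled). 1. If $\mathbb K=\mathbb R$, then for every $k\ge0$ there is a nonempty open set $U\subset\mathbb R^{k+1}$ of $k$-jets such that every jet in $U$ is the $k$-jet $(u(0),u'(0),\dots,u^{(k)}(0))$ of a finite-gap solution $u=\mathcal R(w)$, for some $N$ and some initial condition $(w(0),p(0))$. 2. If $\mathbb K=\mathbb C$, then for every $k\ge0$ there is a Zariski-open, dense set $U\subset\mathbb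 C^{k+1}$ of $k$-jets such that every jet in $U$ is the $k$-jet at $x=0$ of a finite-gap solution, for some $N$ and some initial condition. -/

import Mathlib

open Polynomial Filter Topology

noncomputable section

namespace BKM

section Algebra

variable {F : Type*} [Field F]

/-- The operator in companion form with respect to the coordinates `v₁, …, v_d`: its first column
is `-v`, it has ones directly above the diagonal and zeros elsewhere. -/
def companion {d : ℕ} (v : Fin d → F) : Matrix (Fin d) (Fin d) F :=
  Matrix.of fun i j =>
    (if j.val = 0 then -v i else 0) + (if j.val = i.val + 1 then 1 else 0)

/-- The characteristic polynomial `σ_v(μ) = det (μ Id - companion v)`. -/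
def sigma {d : ℕ} (v : Fin d → F) : F[X] := (companion v).charpoly

/-- The inverse metric `g⁻¹(w)`: ones on the antidiagonal, zeros above it, and `w_s` on the
`s`-th parallel below it. -/
def invMetric {N : ℕ} (w : Fin N → F) : Matrix (Fin N) (Fin N) F :=
  Matrix.of fun i j =>
    if i.val + j.val + 1 = N then 1
    else if h : N ≤ i.val + j.val then w ⟨i.val + j.val - N, by omega⟩
    else 0

/-- The polynomial `½ g⁻¹(det(μ Id - M) (Mᵀ - μ Id)⁻¹ p, p)` in `μ`, where `M = companion w`.
Here `det(μ Id - M) (Mᵀ - μ Id)⁻¹ = -adj(μ Id - Mᵀ)`. -/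
def kineticPoly {N : ℕ} (w p : Fin N → F) : F[X] :=
  C (1 / 2) *
    (((invMetric w).map C).mulVec
      ((-(companion w).transpose.charmatrix.adjugate).mulVec fun j => C (p j))
      ⬝ᵥ fun j => C (p j))

/-- The kinetic energies `K₁, …, K_N` (here `kinetic i` is `K_{i+1}`): the coefficients in
`kineticPoly = K₁ μ^(N-1) + K₂ μ^(N-2) + ⋯ + K_N`. -/
def kinetic {N : ℕ} (i : Fin N) (w p : Fin N → F) : F :=
  (kineticPoly w p).coeff (N - 1 - i.val)

/-- The matrix `f(M) = c(M) m(M)⁻¹` for `f = c / m` and `M = companion w`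
(meaningful where `m(M)` is invertible). -/
def fMatrix {N : ℕ} (m c : F[X]) (w : Fin N → F) : Matrix (Fin N) (Fin N) F :=
  aeval (companion w) c * (aeval (companion w) m)⁻¹

/-- The potentials `V₁, …, V_N` (here `potential m c i` is `V_{i+1}`), defined by
`f(M) = V₁ M^(N-1) + ⋯ + V_N Id`. They are the entries of the last column of `f(M)`;
`potential_spec` and `potential_unique` show that this is the same. -/
def potential {N : ℕ} (m c : F[X]) (i : Fin N) (w : Fin N → F) : F :=
  (fMatrix m c w).mulVec (fun j => if j.val + 1 = N then 1 else 0) i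

/-- The Hamiltonians `H₁, …, H_N` (here `hamiltonian m c i` is `H_{i+1}`). -/
def hamiltonian {N : ℕ} (m c : F[X]) (i : Fin N) (w p : Fin N → F) : F :=
  kinetic i w p + potential m c i w

theorem companion_pow_mulVec {N : ℕ} (w : Fin N → F) (k : ℕ) (hk : k < N) :
    ((companion w) ^ k).mulVec (fun j : Fin N => if j.val + 1 = N then (1 : F) else 0)
      = fun j => if j.val + 1 + k = N then 1 else 0 := by
  induction k with
  | zero => simp
  | succ k ih =>
    rw [pow_succ', ← Matrix.mulVec_mulVec, ih (by omega)]
    funext i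
    have hlt : N - 1 - k < N := by omega
    rw [Matrix.mulVec, dotProduct, Finset.sum_eq_single (⟨N - 1 - k, hlt⟩ : Fin N)]
    · have h1 : N - 1 - k + 1 + k = N := by omega
      have h2 : N - 1 - k ≠ 0 := by omega
      have h3 : (N - 1 - k = i.val + 1) ↔ (i.val + 1 + (k + 1) = N) := by omega
      simp [companion, h1, h2, h3]
    · intro b _ hb
      have : b.val + 1 + k ≠ N := fun h => hb (Fin.ext (by simp; omega))
      simp [this]
    · intro h
      exact absurd (Finset.mem_univ _) h

theorem sum_pow_mulVec {N : ℕ} (w V : Fin N → F) :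
    (∑ i : Fin N, V i • (companion w) ^ (N - 1 - i.val)).mulVec
      (fun j : Fin N => if j.val + 1 = N then (1 : F) else 0) = V := by
  rw [Matrix.sum_mulVec]
  funext j
  rw [Finset.sum_apply, Finset.sum_eq_single j]
  · rw [Matrix.smul_mulVec, companion_pow_mulVec w _ (by omega)]
    have : j.val + 1 + (N - 1 - j.val) = N := by omega
    simp [this]
  · intro b _ hb
    rw [Matrix.smul_mulVec, companion_pow_mulVec w _ (by omega)]
    have : j.val + 1 + (N - 1 - b.val) ≠ N := fun h => hb (Fin.ext (by omega))
    simp [this]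
  · intro h
    exact absurd (Finset.mem_univ _) h

theorem eq_of_commute_of_mulVec {N : ℕ} (w : Fin N → F) (A B : Matrix (Fin N) (Fin N) F)
    (hA : Commute A (companion w)) (hB : Commute B (companion w))
    (h : A.mulVec (fun j : Fin N => if j.val + 1 = N then (1 : F) else 0)
      = B.mulVec (fun j : Fin N => if j.val + 1 = N then (1 : F) else 0)) : A = B := by
  ext i j
  have key : ∀ D : Matrix (Fin N) (Fin N) F, Commute D (companion w) →
      D i j = ((companion w) ^ (N - 1 - j.val)).mulVec
        (D.mulVec (fun j : Fin N => if j.val + 1 = N then (1 : F) else 0)) i := by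
    intro D hD
    rw [Matrix.mulVec_mulVec, ← (hD.pow_right _).eq, ← Matrix.mulVec_mulVec,
      companion_pow_mulVec w _ (by omega), Matrix.mulVec, dotProduct,
      Finset.sum_eq_single j]
    · have : j.val + 1 + (N - 1 - j.val) = N := by omega
      simp [this]
    · intro b _ hb
      have : b.val + 1 + (N - 1 - j.val) ≠ N := fun h => hb (Fin.ext (by omega))
      simp [this]
    · intro h
      exact absurd (Finset.mem_univ _) h
  rw [key A hA, key B hB, h]

theorem fMatrix_commute {N : ℕ} (m c : F[X]) (w : Fin N → F) :
    Commute (fMatrix m c w) (companion w) := by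
  have h1 : ∀ r : F[X], Commute (aeval (companion w) r) (companion w) := by
    intro r
    have := (Commute.all r X).map (aeval (R := F) (companion w))
    simpa using this
  refine Commute.mul_left (h1 c) ?_
  rw [Matrix.nonsing_inv_eq_ringInverse]
  by_cases hu : IsUnit (aeval (companion w) m)
  · obtain ⟨v, hv⟩ := hu
    have h2 := h1 m
    rw [← hv] at h2 ⊢
    rw [Ring.inverse_unit]
    exact h2.units_inv_left
  · rw [Ring.inverse_non_unit _ hu]
    exact Commute.zero_left _

theorem potential_spec {N : ℕ} (m c : F[X]) (w : Fin N → F) :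
    fMatrix m c w = ∑ i : Fin N, potential m c i w • (companion w) ^ (N - 1 - i.val) := by
  apply eq_of_commute_of_mulVec w _ _ (fMatrix_commute m c w)
  · exact Commute.sum_left _ _ _ fun i _ =>
      ((Commute.refl (companion w)).pow_left _).smul_left _
  · rw [sum_pow_mulVec]
    rfl

theorem potential_unique {N : ℕ} (m c : F[X]) (w V : Fin N → F)
    (h : fMatrix m c w = ∑ i : Fin N, V i • (companion w) ^ (N - 1 - i.val)) (i : Fin N) :
    potential m c i w = V i := by
  unfold potential
  rw [h, sum_pow_mulVec]

/-- The implicit definition of the finite-reduction map `u = 𝓡(w)`: the polynomial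
`σ_u σ_w² - c` is divisible by `m`, with a quotient of degree at most `2N - 1`. -/
def IsReduction {n N : ℕ} (m c : F[X]) (w : Fin N → F) (u : Fin n → F) : Prop :=
  ∃ r : F[X], sigma u * sigma w ^ 2 - c = m * r ∧ r.degree < (2 * N : ℕ)

end Algebra

section Dynamics

variable {𝕜 : Type*} [NontriviallyNormedField 𝕜]

/-- Hamilton's equations of `H` at `x`: `(w_i)_x = ∂H/∂p_i` and `(p_i)_x = -∂H/∂w_i`. -/
def HamiltonEquationsAt {N : ℕ} (H : (Fin N → 𝕜) → (Fin N → 𝕜) → 𝕜)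
    (w p : 𝕜 → Fin N → 𝕜) (x : 𝕜) : Prop :=
  ∀ i : Fin N,
    HasDerivAt (fun y => w y i)
      (deriv (fun s => H (w x) (Function.update (p x) i s)) (p x i)) x ∧
    HasDerivAt (fun y => p y i)
      (-deriv (fun s => H (Function.update (w x) i s) (p x)) (w x i)) x

/-- `u = 𝓡(w)` is (near `x = 0`) the spatial profile of an `N`-gap solution of the `n`-component
BKM system with polynomial `m` and parameter `lam ∈ 𝕜 ∪ {∞}`, with respect to the polynomial `c`:
`(w, p)` solves Hamilton's equations of `H₁`, its initial condition lies on the common level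
`H₁ = ⋯ = H_N = 0` (which the flow preserves), and `u` is the image of `w` under the reduction map.
For finite `lam` the time variable of the solution is scaled by a nonzero `a = √c(lam)`, which
has to exist. -/
structure IsFiniteGapSolution {n N : ℕ} (m : 𝕜[X]) (lam : OnePoint 𝕜) (c : 𝕜[X])
    (w p : 𝕜 → Fin N → 𝕜) (u : 𝕜 → Fin n → 𝕜) : Prop where
  gaps : 0 < N
  monic : c.Monic
  natDegree_eq : c.natDegree = 2 * N + n
  normalized : c.coeff (2 * N + n - 1) = 0
  speed : ∀ l : 𝕜, lam = (l : OnePoint 𝕜) → ∃ a : 𝕜, a ≠ 0 ∧ a ^ 2 = c.eval l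
  level : ∀ i : Fin N, hamiltonian m c i (w 0) (p 0) = 0
  regular : ∀ᶠ x in 𝓝 (0 : 𝕜), IsUnit (aeval (companion (w x)) m)
  flow : ∀ᶠ x in 𝓝 (0 : 𝕜), HamiltonEquationsAt (hamiltonian m c ⟨0, gaps⟩) w p x
  reduction : ∀ᶠ x in 𝓝 (0 : 𝕜), IsReduction m c (w x) (u x)

/-- The `k`-jet at `x = 0` of a scalar function, as the tuple of its derivatives of
order `0, …, k`. -/
def jet (k : ℕ) (v : 𝕜 → 𝕜) : Fin (k + 1) → 𝕜 := fun i => iteratedDeriv i.val v 0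

/-- The `k`-jet `j` (of a one-component function) is the `k`-jet at `x = 0` of a finite-gap
solution, for some number of gaps, some polynomial `c` and some initial condition. -/
def IsFiniteGapJet (m : 𝕜[X]) (lam : OnePoint 𝕜) (k : ℕ) (j : Fin (k + 1) → 𝕜) : Prop :=
  ∃ (N : ℕ) (c : 𝕜[X]) (w p : 𝕜 → Fin N → 𝕜) (u : 𝕜 → Fin 1 → 𝕜),
    IsFiniteGapSolution m lam c w p u ∧ jet k (fun x => u x 0) = j

end Dynamics

/-- Zariski-open subsets of `ℂ^ι`: complements of common zero sets of polynomials. -/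
def IsZariskiOpen {ι : Type*} (U : Set (ι → ℂ)) : Prop :=
  ∃ I : Ideal (MvPolynomial ι ℂ), U = (MvPolynomial.zeroLocus ℂ I)ᶜ

end BKM

end

/-! Write `m = m₁(μ - μ₀)` and `σ = σ_w`, a monic polynomial of degree `N` in `μ` that varies with
`x`; primes are `x`-derivatives.

Reduction to one equation. Put `c = (μ + u)σ² + m(½σ'² - σσ'')` (`energyPoly`). Then `c' = σ(u'σ +
2(μ + u)σ' - mσ''')`, so `c` is constant as soon as `mσ''' = u'σ + 2(μ + u)σ'`. Such a profile is a
finite-gap solution (`isFiniteGapSolution_of_profile`). Take as momenta the coefficients of minus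
the polynomial part of `μ^N σ'/σ`, which amounts to `w' = -g⁻¹p`. The kinetic polynomial is then
`-½σ'²` modulo `σ`, while `c ≡ m · ½σ'²` modulo `σ`, so all `H_i` vanish; the reduction condition is
the definition of `c`; and the equation for `p'` is an identity between polynomial parts
(`momentum_derivative_eq`).

Prescribing the jet. Expand `σ = ∑ s_j (μ - μ₀)^j` with `s_N = 1` and set `U = u + μ₀`. The equation
becomes `U's_0 + 2Us_0' = 0`, that is `U = U(0)s_0⁻²` when `s_0(0) = 1`, together with `m₁s_j''' =
U's_{j+1} + 2Us_{j+1}' + 2s_j'` for `j < N`. Read upwards, these relations determine an infinite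
sequence `t_0, t_1, …` from any power series `W` with `W(0) ≠ 0` and the values `t_j(0) = 1`. Read
downwards, they form an ordinary differential equation for `s_0, …, s_{N-1}`. Take `N = k + 2` and
start this equation with the initial data of `t_j` for `j ≤ k`. Cutting off the sequence at the top
loses one order of agreement per level, so `U` still agrees with `W` in its `k`-jet
(`exists_formal_profile`). The formal solution converges because the system is polynomial in the
unknowns and `s_0⁻¹` (`exists_convergesAt`).

The two remaining conditions. The data of `s_{k+1}` do not affect the jet. Its second derivative `θ`
is used to make the subleading coefficient of `c` vanish. Its value `η` then enters `c(λ)`, for `λ ≠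
μ₀`, through a quadratic polynomial in `y = η(λ - μ₀)^(k+1)` with leading coefficient `U(0) - (λ -
μ₀)`. It can be made a nonzero square when this coefficient is positive (over `ℝ`) or nonzero (over
`ℂ`). For `λ = μ₀` one has `c(μ₀) = U(0)`. Hence the open set only restricts `u(0)`. -/

noncomputable section

namespace BKM

open scoped PowerSeries

/-! ### Companion matrices and their characteristic polynomials -/

section CompanionAlgebra

variable {F : Type*} [Field F] {N : ℕ}

/-- The polynomial `v₀ X^(N-1) + v₁ X^(N-2) + ⋯ + v_(N-1)`. -/
def coordPoly (v : Fin N → F) : F[X] := ∑ i : Fin N, C (v i) * X ^ (N - 1 - i.val)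

theorem degree_finsetSum_lt {n : ℕ} {f : Fin n → F[X]} (h : ∀ i, (f i).degree < N) :
    degree (∑ i, f i) < (N : WithBot ℕ) :=
  mem_degreeLT.1 (Submodule.sum_mem _ fun i _ => mem_degreeLT.2 (h i))

theorem coordPoly_eq_sum_range (p : ℕ → F) :
    coordPoly (fun i : Fin N => p (N - 1 - i.val)) = ∑ i ∈ Finset.range N, C (p i) * X ^ i := by
  rw [coordPoly, Fin.sum_univ_eq_sum_range (fun i => C (p (N - 1 - i)) * X ^ (N - 1 - i)) N,
    Finset.sum_range_reflect (fun i => C (p i) * (X : F[X]) ^ i)]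

theorem coeff_coordPoly (v : Fin N → F) (i : Fin N) :
    (coordPoly v).coeff (N - 1 - i.val) = v i := by
  rw [coordPoly, finsetSum_coeff, Finset.sum_eq_single i]
  · simp
  · intro b _ hb
    have : ¬ (N - 1 - i.val = N - 1 - b.val) := fun h => hb (Fin.ext (by omega))
    simp [coeff_X_pow, this]
  · simp

theorem degree_coordPoly_lt (v : Fin N → F) : (coordPoly v).degree < N := by
  refine degree_finsetSum_lt fun i => lt_of_le_of_lt (degree_C_mul_X_pow_le _ _) ?_
  exact_mod_cast (by omega : N - 1 - i.val < N)

theorem coordPoly_coeff (p : F[X]) (hp : p.degree < N) :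
    coordPoly (fun i : Fin N => p.coeff (N - 1 - i.val)) = p := by
  rw [coordPoly_eq_sum_range]
  rcases eq_or_ne p 0 with rfl | h0
  · simp
  · rw [← as_sum_range_C_mul_X_pow' p ((natDegree_lt_iff_degree_lt h0).2 hp)]

theorem sigma_monic (w : Fin N → F) : (sigma w).Monic := Matrix.charpoly_monic _

theorem natDegree_sigma (w : Fin N → F) : (sigma w).natDegree = N := by
  simp [sigma]

theorem degree_sigma (w : Fin N → F) : (sigma w).degree = N := by
  rw [degree_eq_natDegree (sigma_monic w).ne_zero, natDegree_sigma]

theorem degree_sub_X_pow_lt {σ : F[X]} (hσ : σ.Monic) (hN : σ.natDegree = N) :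
    degree (σ - X ^ N) < (N : WithBot ℕ) := by
  have hd : σ.degree = N := by rw [degree_eq_natDegree hσ.ne_zero, hN]
  have := degree_sub_lt_left (p := σ) (q := X ^ N) (by simp [hd]) hσ.ne_zero (by simp [hσ])
  rwa [hd] at this

theorem aeval_companion_sigma (w : Fin N → F) : aeval (companion w) (sigma w) = 0 :=
  Matrix.aeval_self_charpoly _

theorem companion_pow_card_mulVec (w : Fin N → F) :
    ((companion w) ^ N).mulVec (fun j : Fin N => if j.val + 1 = N then (1 : F) else 0) = -w := by
  rcases Nat.eq_zero_or_pos N with rfl | hN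
  · exact Subsingleton.elim _ _
  obtain ⟨n, rfl⟩ := Nat.exists_eq_succ_of_ne_zero hN.ne'
  rw [pow_succ', ← Matrix.mulVec_mulVec, companion_pow_mulVec w n (by omega)]
  funext i
  rw [Matrix.mulVec, dotProduct, Finset.sum_eq_single (0 : Fin (n + 1))]
  · simp [companion, add_comm]
  · intro b _ hb
    have h1 : b.val ≠ 0 := fun h => hb (Fin.ext h)
    have h2 : ¬ (b.val + 1 + n = n + 1) := by omega
    simp [h2]
  · simp

/-- The last basis vector is cyclic: the powers `M^(N-1), …, 1` move it through the whole basis and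
`M^N` sends it to `-w`. Cayley–Hamilton applied to this vector therefore reads off the coefficients.
-/
theorem sigma_eq (w : Fin N → F) : sigma w = X ^ N + coordPoly w := by
  have hd := degree_sub_X_pow_lt (sigma_monic w) (natDegree_sigma w)
  set a : Fin N → F := fun i => (sigma w - X ^ N).coeff (N - 1 - i.val) with ha
  have h1 : sigma w = X ^ N + coordPoly a := by
    rw [ha, coordPoly_coeff _ hd]; ring
  have h2 := aeval_companion_sigma w
  rw [h1] at h2
  have h3 : a = w := by
    have h4 := congrArg (fun A : Matrix (Fin N) (Fin N) F =>
      A.mulVec (fun j : Fin N => if j.val + 1 = N then (1 : F) else 0)) h2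
    simp only [map_add, map_pow, aeval_X, Matrix.add_mulVec, companion_pow_card_mulVec,
      Matrix.zero_mulVec, coordPoly, map_sum, map_mul, aeval_C] at h4
    simp only [← Algebra.smul_def] at h4
    rw [sum_pow_mulVec] at h4
    rw [neg_add_eq_zero] at h4
    exact h4.symm
  rw [h1, h3]

theorem sigma_coeff (w : Fin N → F) (i : Fin N) : (sigma w).coeff (N - 1 - i.val) = w i := by
  have : ¬ (N - 1 - i.val = N) := by omega
  rw [sigma_eq, coeff_add, coeff_coordPoly, coeff_X_pow, if_neg this, zero_add]

theorem sigma_of_coeff {σ : F[X]} (hσ : σ.Monic) (hN : σ.natDegree = N) :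
    sigma (fun i : Fin N => σ.coeff (N - 1 - i.val)) = σ := by
  rw [sigma_eq]
  have : (fun i : Fin N => σ.coeff (N - 1 - i.val))
      = fun i : Fin N => (σ - X ^ N).coeff (N - 1 - i.val) := by
    funext i
    have : ¬ (N - 1 - i.val = N) := by omega
    simp [coeff_X_pow, this]
  rw [this, coordPoly_coeff _ (degree_sub_X_pow_lt hσ hN)]
  ring

theorem sigma_one (u : Fin 1 → F) : sigma u = X + C (u 0) := by
  simp [sigma_eq, coordPoly]

/-! ### The inverse metric, momenta and kinetic energies as polynomials -/

theorem invMetric_apply (w : Fin N → F) (i j : Fin N) :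
    invMetric w i j = (sigma w).coeff (2 * N - 1 - i.val - j.val) := by
  rw [invMetric, Matrix.of_apply]
  split_ifs with h1 h2
  · have : 2 * N - 1 - i.val - j.val = N := by omega
    rw [this]
    have := (sigma_monic w).coeff_natDegree
    rw [natDegree_sigma] at this
    exact this.symm
  · have : 2 * N - 1 - i.val - j.val = N - 1 - (⟨i.val + j.val - N, by omega⟩ : Fin N).val := by
      simp only; omega
    rw [this, sigma_coeff]
  · rw [coeff_eq_zero_of_natDegree_lt]
    rw [natDegree_sigma]
    omega

theorem invMetric_symm (w : Fin N → F) (i j : Fin N) : invMetric w i j = invMetric w j i := by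
  rw [invMetric_apply, invMetric_apply]
  congr 1
  omega

/-- The polynomial `p₀ + p₁ X + ⋯ + p_(N-1) X^(N-1)`. -/
def momentumPoly (p : Fin N → F) : F[X] := ∑ j : Fin N, C (p j) * X ^ j.val

theorem momentumPoly_coeff (P : F[X]) (hP : P.degree < N) :
    momentumPoly (fun j : Fin N => P.coeff j.val) = P := by
  rw [momentumPoly, Fin.sum_univ_eq_sum_range (fun j => C (P.coeff j) * X ^ j)]
  rcases eq_or_ne P 0 with rfl | h0
  · simp
  · rw [← as_sum_range_C_mul_X_pow' P ((natDegree_lt_iff_degree_lt h0).2 hP)]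

theorem degree_momentumPoly_lt (p : Fin N → F) : (momentumPoly p).degree < N := by
  refine degree_finsetSum_lt fun i => lt_of_le_of_lt (degree_C_mul_X_pow_le _ _) ?_
  exact_mod_cast i.isLt

theorem coeff_momentumPoly (p : Fin N → F) (j : Fin N) : (momentumPoly p).coeff j.val = p j := by
  rw [momentumPoly, finsetSum_coeff, Finset.sum_eq_single j]
  · simp
  · intro b _ hb
    have : ¬ (j.val = b.val) := fun h => hb (Fin.ext h.symm)
    simp [coeff_X_pow, this]
  · simp

theorem invMetric_mulVec (w p : Fin N → F) (i : Fin N) :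
    (invMetric w).mulVec p i = (momentumPoly p * sigma w).coeff (2 * N - 1 - i.val) := by
  rw [Matrix.mulVec, dotProduct, momentumPoly, Finset.sum_mul, finsetSum_coeff]
  refine Finset.sum_congr rfl fun j _ => ?_
  have h : j.val ≤ 2 * N - 1 - i.val := by omega
  rw [mul_assoc, coeff_C_mul, coeff_X_pow_mul', if_pos h, invMetric_apply, mul_comm]

theorem degree_mul_lt_of_lt {p q : F[X]} {a b : ℕ} (hp : p.degree < a) (hq : q.degree ≤ b) :
    (p * q).degree < (a + b : ℕ) := by
  rcases eq_or_ne p 0 with rfl | h0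
  · simp
  rcases eq_or_ne q 0 with rfl | h1
  · simp
  rw [degree_mul, degree_eq_natDegree h0, degree_eq_natDegree h1]
  rw [degree_eq_natDegree h0] at hp
  rw [degree_eq_natDegree h1] at hq
  norm_cast at hp hq ⊢
  omega

/-- The momentum polynomial of the velocity polynomial `τ`: minus the polynomial part of
`X ^ N * τ / σ`. -/
def momentumOf (N : ℕ) (σ τ : F[X]) : F[X] := -((X ^ N * τ) /ₘ σ)

theorem momentumOf_spec {σ τ : F[X]} :
    X ^ N * τ + momentumOf N σ τ * σ = (X ^ N * τ) %ₘ σ := by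
  rw [momentumOf, modByMonic_eq_sub_mul_div]
  ring

theorem degree_momentumOf_lt {σ τ : F[X]} (hσ : σ.Monic) (hN : σ.natDegree = N)
    (hτ : τ.degree < N) : (momentumOf N σ τ).degree < N := by
  rw [momentumOf, degree_neg]
  rcases Nat.eq_zero_or_pos N with rfl | hpos
  · have : τ = 0 := by
      rw [← degree_eq_bot]
      exact Nat.WithBot.lt_zero_iff.1 hτ
    simp [this]
  by_cases hX : σ.degree ≤ (X ^ N * τ).degree
  · have h1 := degree_add_divByMonic hσ hX
    have hd : σ.degree = N := by rw [degree_eq_natDegree hσ.ne_zero, hN]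
    have h2 : degree (τ * X ^ N) < ((N + N : ℕ) : WithBot ℕ) := degree_mul_lt_of_lt hτ (by simp)
    rw [mul_comm τ, ← h1, hd] at h2
    rcases eq_or_ne ((X ^ N * τ) /ₘ σ) 0 with h0 | h0
    · rw [h0]; simp
    · rw [degree_eq_natDegree h0] at h2 ⊢
      norm_cast at h2 ⊢
      omega
  · rw [(divByMonic_eq_zero_iff hσ).2 (not_le.1 hX)]
    simp

theorem momentumOf_unique {σ τ P : F[X]} (hσ : σ.Monic) (hN : σ.natDegree = N)
    (h : degree (X ^ N * τ + P * σ) < (N : WithBot ℕ)) : P = momentumOf N σ τ := by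
  have hd : σ.degree = N := by rw [degree_eq_natDegree hσ.ne_zero, hN]
  have := (div_modByMonic_unique (f := X ^ N * τ) (-P) (X ^ N * τ + P * σ) hσ
    ⟨by ring, by rwa [hd]⟩).1
  rw [momentumOf, this, neg_neg]

/-- Both sides are the coefficient of `X^(-1)` in the expansion of `X^(N-1-s) G / σ` at infinity.
The lemma connects the momenta, which come from quotients, with the remainders that appear in the
adjugate and in the gradient of the potential. -/
theorem coeff_divByMonic_X_pow_mul {σ : F[X]} (hσ : σ.Monic) (hN : σ.natDegree = N) (G : F[X])
    {s : ℕ} (hs : s < N) :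
    ((X ^ N * G) /ₘ σ).coeff s = ((X ^ (N - 1 - s) * G) %ₘ σ).coeff (N - 1) := by
  have hd : σ.degree = N := by rw [degree_eq_natDegree hσ.ne_zero, hN]
  set H := X ^ (N - 1 - s) * G with hH
  set r := H %ₘ σ with hr
  have hr' : r.degree < N := by rw [← hd]; exact degree_modByMonic_lt _ hσ
  have h1 : X ^ N * G = X ^ (s + 1) * (r + σ * (H /ₘ σ)) := by
    rw [modByMonic_add_div, hH, ← mul_assoc, ← pow_add]
    congr 2; omega
  -- Only the remainder `r` matters: the exact part contributes a multiple of `X^(s+1)` to the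
  -- quotient, invisible at degree `s`. What is left is the leading coefficient of `t`, whose degree
  -- is at most `s`.
  set t := (X ^ (s + 1) * r) /ₘ σ with ht
  have h2 : (X ^ N * G) /ₘ σ = X ^ (s + 1) * (H /ₘ σ) + t := by
    refine (div_modByMonic_unique _ ((X ^ (s + 1) * r) %ₘ σ) hσ ⟨?_, ?_⟩).1
    · have := modByMonic_add_div (X ^ (s + 1) * r) (q := σ)
      rw [h1]
      linear_combination this
    · exact degree_modByMonic_lt _ hσ
  have h3 := modByMonic_add_div (X ^ (s + 1) * r) (q := σ)
  have h4 : ((X ^ (s + 1) * r) %ₘ σ).degree < N := by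
    rw [← hd]; exact degree_modByMonic_lt _ hσ
  rw [h2, coeff_add, coeff_X_pow_mul', if_neg (by omega), zero_add]
  have ht' : t.degree ≤ s := by
    by_contra! hlt
    have h0 : t ≠ 0 := by rintro h; rw [h] at hlt; simp at hlt
    have h5 : degree (r * X ^ (s + 1)) < ((N + (s + 1) : ℕ) : WithBot ℕ) := degree_mul_lt_of_lt hr' (by simp)
    have h6 : ((X ^ (s + 1) * r) %ₘ σ).degree < (σ * t).degree := by
      refine lt_of_lt_of_le h4 ?_
      rw [degree_mul, hd, degree_eq_natDegree h0]
      norm_cast; omega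
    have h7 := degree_add_eq_right_of_degree_lt h6
    rw [h3, mul_comm _ r] at h7
    rw [h7, Polynomial.degree_mul, hd, degree_eq_natDegree h0] at h5
    rw [degree_eq_natDegree h0] at hlt
    norm_cast at h5 hlt
    omega
  have h5 : (σ * t).coeff (N + s) = t.coeff s := by
    have := coeff_mul_add_eq_of_natDegree_le (df := N) (dg := s) (f := σ) (g := t) hN.le
      (natDegree_le_of_degree_le ht')
    rw [this, ← hN, hσ.coeff_natDegree, one_mul]
  have h6 := congrArg (fun q => coeff q (N + s)) h3
  simp only [coeff_add] at h6
  rw [← ht, h5, coeff_eq_zero_of_degree_lt (lt_of_lt_of_le h4 (by exact_mod_cast Nat.le_add_right _ _)),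
    zero_add, coeff_X_pow_mul', if_pos (by omega)] at h6
  rw [h6]
  congr 1
  omega

theorem coeff_momentumOf {σ : F[X]} (hσ : σ.Monic) (hN : σ.natDegree = N) (τ : F[X])
    {s : ℕ} (hs : s < N) :
    (momentumOf N σ τ).coeff s = -((X ^ (N - 1 - s) * τ) %ₘ σ).coeff (N - 1) := by
  rw [momentumOf, coeff_neg, coeff_divByMonic_X_pow_mul hσ hN τ hs]

/-- In degrees `N` and above the remainder in `momentumOf_spec` vanishes, so there `X^N τ` cancels
against `P σ`. For `τ = σ'` this is the Legendre relation `w' = -g⁻¹p`. -/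
theorem invMetric_mulVec_momentumOf (w : Fin N → F) {τ : F[X]} (hτ : τ.degree < N) (i : Fin N) :
    (invMetric w).mulVec (fun j => (momentumOf N (sigma w) τ).coeff j.val) i
      = -τ.coeff (N - 1 - i.val) := by
  rw [invMetric_mulVec,
    momentumPoly_coeff _ (degree_momentumOf_lt (sigma_monic w) (natDegree_sigma w) hτ)]
  have h := congrArg (fun q => coeff q (2 * N - 1 - i.val))
    (momentumOf_spec (N := N) (τ := τ) (σ := sigma w))
  have h4 : ((X ^ N * τ) %ₘ sigma w).degree < N := by
    rw [← degree_sigma w]; exact degree_modByMonic_lt _ (sigma_monic w)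
  simp only [coeff_add] at h
  rw [coeff_eq_zero_of_degree_lt (lt_of_lt_of_le h4 (by
      exact_mod_cast (by omega : N ≤ 2 * N - 1 - i.val))), coeff_X_pow_mul', if_pos (by omega),
      add_comm] at h
  have e : 2 * N - 1 - i.val - N = N - 1 - i.val := by omega
  rw [e] at h
  exact eq_neg_of_add_eq_zero_left h

/-- Invertibility of `g⁻¹` in polynomial form: take `τ` with coordinates `-g⁻¹p`. It lets identities
for arbitrary `p` be proved through `τ`. -/
theorem exists_momentumOf_eq (w p : Fin N → F) : ∃ τ : F[X], τ.degree < N ∧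
    p = fun j => (momentumOf N (sigma w) τ).coeff j.val := by
  refine ⟨coordPoly fun i => -(invMetric w).mulVec p i, degree_coordPoly_lt _, ?_⟩
  have h : momentumPoly p = momentumOf N (sigma w)
      (coordPoly fun i => -(invMetric w).mulVec p i) := by
    refine momentumOf_unique (sigma_monic w) (natDegree_sigma w) ?_
    rw [degree_lt_iff_coeff_zero]
    intro n hn
    by_cases hn2 : n < 2 * N
    · have e : n = 2 * N - 1 - (2 * N - 1 - n) := by omega
      have e' : n - N = N - 1 - (⟨2 * N - 1 - n, by omega⟩ : Fin N).val := by simp only; omega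
      rw [coeff_add, coeff_X_pow_mul', if_pos hn, e', coeff_coordPoly, invMetric_mulVec]
      simp only [← e, neg_add_cancel]
    · have h1 : degree (coordPoly (fun i => -(invMetric w).mulVec p i) * X ^ N) < ((N + N : ℕ) : WithBot ℕ) :=
        degree_mul_lt_of_lt (degree_coordPoly_lt _) (by simp)
      have h2 : degree (momentumPoly p * sigma w) < ((N + N : ℕ) : WithBot ℕ) :=
        degree_mul_lt_of_lt (degree_momentumPoly_lt _) (degree_sigma w).le
      have h3 : ((N + N : ℕ) : WithBot ℕ) ≤ n := by exact_mod_cast (by omega : N + N ≤ n)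
      rw [coeff_add, mul_comm, coeff_eq_zero_of_degree_lt (h1.trans_le h3),
        coeff_eq_zero_of_degree_lt (h2.trans_le h3), add_zero]
  rw [← h]
  funext j
  rw [coeff_momentumPoly]

theorem eq_C_mul_of_dvd {σ q : F[X]} (hσ : σ.Monic) (hN : σ.natDegree = N) (h : σ ∣ q)
    (hq : q.degree ≤ N) : q = C (q.coeff N) * σ := by
  obtain ⟨t, rfl⟩ := h
  have hd : σ.degree = N := by rw [degree_eq_natDegree hσ.ne_zero, hN]
  have ht : t.degree ≤ 0 := by
    rcases eq_or_ne t 0 with rfl | h0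
    · simp
    rw [degree_mul, hd, degree_eq_natDegree h0] at hq
    rw [degree_eq_natDegree h0]
    norm_cast at hq ⊢
    omega
  rw [eq_C_of_degree_le_zero ht, coeff_mul_C, ← hN, hσ.coeff_natDegree, one_mul, mul_comm]

/-- The vector of remainders `h_j = X^(N-1-j) τ mod σ` solves `(X - Mᵀ) h = -σ p`; multiplying by
the adjugate and cancelling `σ = det(X - Mᵀ)` gives the formula. -/
theorem adjugate_charmatrix_mulVec (w : Fin N → F) (τ : F[X]) :
    (companion w).transpose.charmatrix.adjugate.mulVec
        (fun j : Fin N => C ((momentumOf N (sigma w) τ).coeff j.val))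
      = fun j : Fin N => -((X ^ (N - 1 - j.val) * τ) %ₘ sigma w) := by
  set σ := sigma w with hσdef
  have hσ : σ.Monic := sigma_monic w
  have hN : σ.natDegree = N := natDegree_sigma w
  have hd : σ.degree = N := degree_sigma w
  set h : ℕ → F[X] := fun j => (X ^ (N - 1 - j) * τ) %ₘ σ with hh
  have hdeg : ∀ j, (h j).degree < N := fun j => by rw [← hd]; exact degree_modByMonic_lt _ hσ
  have hdvd : ∀ j, σ ∣ X ^ (N - 1 - j) * τ - h j := fun j =>
    ⟨(X ^ (N - 1 - j) * τ) /ₘ σ, by simp only [hh, modByMonic_eq_sub_mul_div]; ring⟩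
  set p : ℕ → F := fun j => (momentumOf N σ τ).coeff j with hp
  have key : (companion w).transpose.charmatrix.mulVec (fun j : Fin N => h j.val)
      = fun j : Fin N => -σ * C (p j.val) := by
    funext j
    have hcoeff : ∀ q : F[X], q.degree < N → (X * h j.val + q).coeff N = -p j.val := by
      intro q hq
      obtain ⟨n, hn⟩ : ∃ n, N = n + 1 := ⟨N - 1, by have := j.isLt; omega⟩
      rw [coeff_add, coeff_eq_zero_of_degree_lt hq, add_zero, hp]
      simp only
      rw [coeff_momentumOf hσ hN τ j.isLt, neg_neg]
      simp only [hn, coeff_X_mul, Nat.add_sub_cancel, hh]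
    have hdegle : ∀ q : F[X], q.degree < N → degree (X * h j.val + q) ≤ (N : WithBot ℕ) := by
      intro q hq
      refine (degree_add_le _ _).trans (max_le ?_ hq.le)
      have : degree (h j.val * X) < ((N + 1 : ℕ) : WithBot ℕ) := degree_mul_lt_of_lt (hdeg _) (by simp)
      rw [mul_comm] at this
      exact Order.lt_succ_iff.1 this
    have fin : ∀ q : F[X], q.degree < N → σ ∣ X * h j.val + q →
        X * h j.val + q = -σ * C (p j.val) := by
      intro q hq hq'
      rw [eq_C_mul_of_dvd hσ hN hq' (hdegle q hq), hcoeff q hq]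
      simp [mul_comm]
    have expand : (companion w).transpose.charmatrix.mulVec (fun j : Fin N => h j.val) j
        = X * h j.val - ∑ k : Fin N, C (companion w k j) * h k.val := by
      rw [Matrix.charmatrix, Matrix.sub_mulVec, Pi.sub_apply]
      congr 1
      simp [Matrix.scalar_apply, Matrix.mulVec_diagonal]
    rw [expand]
    -- Each row is divisible by `σ` and has degree at most `N`, hence is a constant times `σ`. Row
    -- `0` uses `X^N + ∑ w_k X^(N-1-k) = σ`; every other row uses `X h_j ≡ h_{j-1}` modulo `σ`.
    rcases Nat.eq_zero_or_pos j.val with h0 | h0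
    · have e1 : ∑ k : Fin N, C (companion w k j) * h k.val = -∑ k : Fin N, C (w k) * h k.val := by
        rw [← Finset.sum_neg_distrib]
        refine Finset.sum_congr rfl fun k _ => ?_
        simp [companion, h0]
      rw [e1, sub_neg_eq_add]
      refine fin _ ?_ ?_
      · refine degree_finsetSum_lt fun k => ?_
        exact lt_of_le_of_lt (by rw [← smul_eq_C_mul]; exact degree_smul_le _ _) (hdeg k.val)
      · have e2 : X * h j.val + ∑ k : Fin N, C (w k) * h k.val
            = σ * τ - (X * (X ^ (N - 1 - j.val) * τ - h j.val)
              + ∑ k : Fin N, C (w k) * (X ^ (N - 1 - k.val) * τ - h k.val)) := by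
          have e3 : X * (X ^ (N - 1 - j.val)) = (X : F[X]) ^ N := by
            rw [← pow_succ', h0]; congr 1; omega
          rw [hσdef, sigma_eq, coordPoly, add_mul, Finset.sum_mul]
          simp only [mul_sub, Finset.sum_sub_distrib]
          rw [← mul_assoc, e3]
          simp only [mul_assoc]
          ring
        rw [e2]
        refine dvd_sub (dvd_mul_right _ _) (dvd_add (Dvd.dvd.mul_left (hdvd _) _)
          (Finset.dvd_sum fun k _ => Dvd.dvd.mul_left (hdvd _) _))
    · have e1 : ∑ k : Fin N, C (companion w k j) * h k.val = h (j.val - 1) := by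
        rw [Finset.sum_eq_single (⟨j.val - 1, by omega⟩ : Fin N)]
        · have : j.val = j.val - 1 + 1 := by omega
          simp [companion, h0.ne', ← this]
        · intro k _ hk
          have : ¬ (j.val = k.val + 1) := fun hjk => hk (Fin.ext (by simp; omega))
          simp [companion, h0.ne', this]
        · simp
      rw [e1, sub_eq_add_neg]
      refine fin _ (by rw [degree_neg]; exact hdeg _) ?_
      have e2 : X * h j.val + -h (j.val - 1) = (X ^ (N - 1 - (j.val - 1)) * τ - h (j.val - 1))
          - X * (X ^ (N - 1 - j.val) * τ - h j.val) := by
        have e3 : N - 1 - (j.val - 1) = N - 1 - j.val + 1 := by omega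
        rw [e3, pow_succ']
        ring
      rw [e2]
      exact dvd_sub (hdvd _) (Dvd.dvd.mul_left (hdvd _) _)
  have h2 := congrArg (fun v => (companion w).transpose.charmatrix.adjugate.mulVec v) key
  simp only [Matrix.mulVec_mulVec, Matrix.adjugate_mul, Matrix.smul_mulVec, Matrix.one_mulVec] at h2
  have h3 : (companion w).transpose.charmatrix.det = σ := by
    rw [hσdef, sigma, ← Matrix.charpoly_transpose (companion w)]; rfl
  rw [h3] at h2
  have h4 : (fun j : Fin N => -σ * C (p j.val)) = (-σ) • fun j : Fin N => C (p j.val) := by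
    funext j; simp
  rw [h4, Matrix.mulVec_smul] at h2
  funext j
  have h5 := congrFun h2 j
  simp only [Pi.smul_apply, smul_eq_mul] at h5
  have h6 : σ * (h j.val + (companion w).transpose.charmatrix.adjugate.mulVec
      (fun j : Fin N => C (p j.val)) j) = 0 := by linear_combination h5
  rw [mul_eq_zero, or_iff_right hσ.ne_zero] at h6
  exact eq_neg_of_add_eq_zero_right h6

theorem kineticPoly_momentumOf_eq_sum (w : Fin N → F) {τ : F[X]} (hτ : τ.degree < N) :
    kineticPoly w (fun j => (momentumOf N (sigma w) τ).coeff j.val)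
      = C (1 / 2) * ∑ j : Fin N, -C (τ.coeff (N - 1 - j.val)) *
          ((X ^ (N - 1 - j.val) * τ) %ₘ sigma w) := by
  have h1 : ∀ v : Fin N → F[X], ((invMetric w).map C).mulVec v ⬝ᵥ
      (fun j => C ((momentumOf N (sigma w) τ).coeff j.val))
      = ∑ j : Fin N, v j * C ((invMetric w).mulVec
          (fun j => (momentumOf N (sigma w) τ).coeff j.val) j) := by
    intro v
    simp only [dotProduct, Matrix.mulVec, map_sum, map_mul, Finset.mul_sum, Finset.sum_mul,
      Matrix.map_apply]
    rw [Finset.sum_comm]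
    refine Finset.sum_congr rfl fun i _ => Finset.sum_congr rfl fun j _ => ?_
    rw [invMetric_symm w j i]
    ring
  rw [kineticPoly, h1, Matrix.neg_mulVec, adjugate_charmatrix_mulVec]
  congr 1
  refine Finset.sum_congr rfl fun j _ => ?_
  rw [invMetric_mulVec_momentumOf w hτ]
  simp [mul_comm]

theorem sum_coeff_mul_modByMonic {σ τ : F[X]} (hτ : τ.degree < N) :
    ∑ j : Fin N, C (τ.coeff (N - 1 - j.val)) * ((X ^ (N - 1 - j.val) * τ) %ₘ σ)
      = (τ ^ 2) %ₘ σ := by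
  have h1 : τ ^ 2 = ∑ j : Fin N, τ.coeff (N - 1 - j.val) • (X ^ (N - 1 - j.val) * τ) := by
    have h2 := congrArg (· * τ) (coordPoly_coeff τ hτ)
    simp only [coordPoly, Finset.sum_mul] at h2
    rw [pow_two, ← h2]
    simp [smul_eq_C_mul, mul_assoc]
  have h2 := map_sum (modByMonicHom σ)
    (fun j : Fin N => τ.coeff (N - 1 - j.val) • (X ^ (N - 1 - j.val) * τ)) Finset.univ
  simp only [map_smul, modByMonicHom_apply] at h2
  rw [h1, h2]
  simp [smul_eq_C_mul]

/-- Pairing the remainders `X^i τ mod σ` with `g⁻¹p`, whose entries are minus the coefficients of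
`τ`, reassembles `τ · τ` modulo `σ`. -/
theorem kineticPoly_momentumOf (w : Fin N → F) {τ : F[X]} (hτ : τ.degree < N) :
    kineticPoly w (fun j => (momentumOf N (sigma w) τ).coeff j.val)
      = -(C (1 / 2) * ((τ ^ 2) %ₘ sigma w)) := by
  rw [kineticPoly_momentumOf_eq_sum w hτ, ← sum_coeff_mul_modByMonic hτ]
  simp [Finset.sum_neg_distrib]

/-- `K₁` sees only the coefficients of `X^(N-1)` in the remainders, and by `coeff_momentumOf` these
are `-p_j`. This is the form that can be differentiated in `w` and `p`. -/
theorem kinetic_zero (hN : 0 < N) (w p : Fin N → F) :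
    kinetic ⟨0, hN⟩ w p = -(1 / 2 * ∑ i, ∑ j, p i * invMetric w i j * p j) := by
  obtain ⟨τ, hτ, rfl⟩ := exists_momentumOf_eq w p
  rw [kinetic, kineticPoly_momentumOf_eq_sum w hτ, coeff_C_mul, finsetSum_coeff, ← mul_neg,
    ← Finset.sum_neg_distrib]
  congr 1
  refine Finset.sum_congr rfl fun i _ => ?_
  have h1 := invMetric_mulVec_momentumOf w hτ i
  rw [Matrix.mulVec, dotProduct] at h1
  simp only [mul_assoc, ← Finset.mul_sum]
  rw [h1, ← C_neg, coeff_C_mul, coeff_momentumOf (sigma_monic w) (natDegree_sigma w) τ i.isLt]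
  simp only [Nat.sub_zero]
  ring

theorem isUnit_aeval_of_eq_add {w : Fin N → F} {m q r : F[X]} {a : F} (ha : a ≠ 0)
    (h : m * q = C a + sigma w * r) : IsUnit (aeval (companion w) m) := by
  have h1 := congrArg (aeval (companion w)) h
  rw [map_mul, map_add, map_mul, aeval_companion_sigma, zero_mul, add_zero, aeval_C] at h1
  have h2 : IsUnit (algebraMap F (Matrix (Fin N) (Fin N) F) a) :=
    (IsUnit.mk0 a ha).map (algebraMap F (Matrix (Fin N) (Fin N) F))
  rw [← h1] at h2
  exact (Commute.isUnit_mul_iff ((Commute.all m q).map (aeval (companion w)))).1 h2 |>.1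

/-- Division of `σ` by `X - μ₀` is a Bézout relation: `m` times the quotient equals `-m₁ σ(μ₀)` plus
a multiple of `σ`, and `σ(M) = 0`. -/
theorem isUnit_aeval_of_eval_ne_zero {w : Fin N → F} {m₁ μ₀ : F} (h : (sigma w).eval μ₀ ≠ 0) :
    m₁ ≠ 0 → IsUnit (aeval (companion w) (C m₁ * (X - C μ₀))) := by
  intro h1
  refine isUnit_aeval_of_eq_add (q := sigma w /ₘ (X - C μ₀)) (r := C m₁)
    (a := -(m₁ * (sigma w).eval μ₀)) (neg_ne_zero.2 (mul_ne_zero h1 h)) ?_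
  have h2 := modByMonic_add_div (sigma w) (q := X - C μ₀)
  rw [modByMonic_X_sub_C_eq_C_eval] at h2
  rw [C_neg, C_mul]
  linear_combination C m₁ * h2

/-- Since `σ(M) = 0`, the matrix `c(M) m(M)⁻¹` depends only on `c / m` modulo `σ`, so the potentials
are the coefficients of the reduced representative `V`. -/
theorem potential_eq_coeff {m c V B : F[X]} {w : Fin N → F}
    (hu : IsUnit (aeval (companion w) m)) (hV : V.degree < N) (h : c = m * V + sigma w * B)
    (i : Fin N) : potential m c i w = V.coeff (N - 1 - i.val) := by
  refine potential_unique m c w (fun i => V.coeff (N - 1 - i.val)) ?_ i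
  have h1 : ∑ i : Fin N, V.coeff (N - 1 - i.val) • companion w ^ (N - 1 - i.val)
      = aeval (companion w) V := by
    conv_rhs => rw [← coordPoly_coeff V hV, coordPoly]
    simp [map_sum, Algebra.smul_def]
  rw [h1, fMatrix, h, map_add, map_mul, map_mul, aeval_companion_sigma, zero_mul, add_zero,
    ← map_mul, mul_comm, map_mul, Matrix.mul_assoc, Matrix.mul_nonsing_inv, Matrix.mul_one]
  exact (Matrix.isUnit_iff_isUnit_det _).1 hu

end CompanionAlgebra

/-! ### Differentiating polynomial-valued functions, quotients and remainders -/

section PolynomialCalculus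

variable {𝕜 : Type*} [NontriviallyNormedField 𝕜]

/-- The coefficients of the polynomial-valued function `f` have at `x` the coefficients of `f'` as
derivatives. -/
def PolyHasDerivAt (f : 𝕜 → 𝕜[X]) (f' : 𝕜[X]) (x : 𝕜) : Prop :=
  ∀ n, HasDerivAt (fun y => (f y).coeff n) (f'.coeff n) x

namespace PolyHasDerivAt

variable {f g : 𝕜 → 𝕜[X]} {f' g' : 𝕜[X]} {x : 𝕜}

theorem const (p : 𝕜[X]) (x : 𝕜) : PolyHasDerivAt (fun _ => p) 0 x := fun n => by
  simpa using hasDerivAt_const x (p.coeff n)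

theorem add (hf : PolyHasDerivAt f f' x) (hg : PolyHasDerivAt g g' x) :
    PolyHasDerivAt (fun y => f y + g y) (f' + g') x := fun n => by
  simpa using (hf n).fun_add (hg n)

theorem neg (hf : PolyHasDerivAt f f' x) : PolyHasDerivAt (fun y => -f y) (-f') x := fun n => by
  simpa using (hf n).fun_neg

theorem sub (hf : PolyHasDerivAt f f' x) (hg : PolyHasDerivAt g g' x) :
    PolyHasDerivAt (fun y => f y - g y) (f' - g') x := fun n => by
  simpa using (hf n).fun_sub (hg n)

theorem mul (hf : PolyHasDerivAt f f' x) (hg : PolyHasDerivAt g g' x) :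
    PolyHasDerivAt (fun y => f y * g y) (f' * g x + f x * g') x := fun n => by
  simp only [coeff_mul, coeff_add, ← Finset.sum_add_distrib]
  exact HasDerivAt.fun_sum fun i _ => (hf i.1).fun_mul (hg i.2)

theorem C {a : 𝕜 → 𝕜} {a' : 𝕜} (ha : HasDerivAt a a' x) :
    PolyHasDerivAt (fun y => Polynomial.C (a y)) (Polynomial.C a') x := fun n => by
  simp only [coeff_C]
  split_ifs
  · exact ha
  · exact hasDerivAt_const _ _

theorem const_mul (p : 𝕜[X]) (hf : PolyHasDerivAt f f' x) :
    PolyHasDerivAt (fun y => p * f y) (p * f') x := by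
  simpa using (const p x).mul hf

theorem unique (hf : PolyHasDerivAt f f' x) (hg : PolyHasDerivAt g g' x) (h : f =ᶠ[𝓝 x] g) :
    f' = g' := by
  ext n
  refine (hf n).unique ((hg n).congr_of_eventuallyEq ?_)
  filter_upwards [h] with y hy
  rw [hy]

theorem degree_lt {N : ℕ} (hf : PolyHasDerivAt f f' x) (h : ∀ y, (f y).degree < N) :
    f'.degree < N := by
  rw [degree_lt_iff_coeff_zero]
  intro n hn
  have h1 : (fun y => (f y).coeff n) = fun _ => 0 := by
    funext y
    exact coeff_eq_zero_of_degree_lt ((h y).trans_le (by exact_mod_cast hn))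
  have h2 := hf n
  rw [h1] at h2
  exact h2.unique (hasDerivAt_const _ _)

end PolyHasDerivAt

/-- The ring of functions differentiable at `x`. -/
def differentiableSubring (x : 𝕜) : Subring (𝕜 → 𝕜) where
  carrier := {f | DifferentiableAt 𝕜 f x}
  mul_mem' := fun hf hg => DifferentiableAt.mul hf hg
  one_mem' := differentiableAt_const 1
  add_mem' := fun hf hg => DifferentiableAt.add hf hg
  zero_mem' := differentiableAt_const 0
  neg_mem' := fun hf => DifferentiableAt.neg hf

/-- Evaluation at `y`, on the ring of functions differentiable at `x`. -/
def differentiableEval (x y : 𝕜) : differentiableSubring x →+* 𝕜 :=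
  (Pi.evalRingHom (fun _ : 𝕜 => 𝕜) y).comp (differentiableSubring x).subtype

/-- A polynomial-valued function of bounded degree with differentiable coefficients, as a
polynomial over the ring of differentiable functions. -/
theorem exists_map_differentiableEval {f : 𝕜 → 𝕜[X]} {f' : 𝕜[X]} {x : 𝕜}
    (hf : PolyHasDerivAt f f' x) {d : ℕ} (hd : ∀ y, (f y).natDegree < d) :
    ∃ F : (differentiableSubring x)[X], (∀ y, F.map (differentiableEval x y) = f y) ∧
      ∀ n, ((F.coeff n : 𝕜 → 𝕜)) = fun y => (f y).coeff n := by
  have key : ∀ n, (((∑ i ∈ Finset.range d,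
      Polynomial.C (⟨fun y => (f y).coeff i, (hf i).differentiableAt⟩ : differentiableSubring x)
        * X ^ i).coeff n : differentiableSubring x) : 𝕜 → 𝕜) = fun y => (f y).coeff n := by
    intro n
    simp only [finsetSum_coeff, coeff_C_mul, coeff_X_pow]
    by_cases hn : n < d
    · rw [Finset.sum_eq_single n]
      · simp
      · intro b _ hb
        simp [hb.symm]
      · intro h
        exact absurd (Finset.mem_range.2 hn) h
    · rw [Finset.sum_eq_zero]
      · funext y
        exact (coeff_eq_zero_of_natDegree_lt ((hd y).trans_le (not_lt.1 hn))).symm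
      · intro b hb
        have : n ≠ b := by have := Finset.mem_range.1 hb; omega
        simp [this]
  refine ⟨_, fun y => ?_, key⟩
  ext n
  rw [coeff_map]
  exact congrFun (key n) y

theorem exists_polyHasDerivAt_of_map {x : 𝕜} (F : (differentiableSubring x)[X]) :
    ∃ q, PolyHasDerivAt (fun y => F.map (differentiableEval x y)) q x := by
  refine ⟨∑ i ∈ Finset.range (F.natDegree + 1),
    Polynomial.C (deriv (F.coeff i : 𝕜 → 𝕜) x) * X ^ i, fun n => ?_⟩
  have h1 : (fun y => (F.map (differentiableEval x y)).coeff n) = (F.coeff n : 𝕜 → 𝕜) := by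
    funext y
    rw [coeff_map]
    rfl
  rw [h1]
  have h2 : (∑ i ∈ Finset.range (F.natDegree + 1),
      Polynomial.C (deriv (F.coeff i : 𝕜 → 𝕜) x) * X ^ i).coeff n
      = deriv (F.coeff n : 𝕜 → 𝕜) x := by
    simp only [finsetSum_coeff, coeff_C_mul, coeff_X_pow]
    by_cases hn : n < F.natDegree + 1
    · rw [Finset.sum_eq_single n]
      · simp
      · intro b _ hb
        simp [hb.symm]
      · intro h
        exact absurd (Finset.mem_range.2 hn) h
    · rw [Finset.sum_eq_zero, coeff_eq_zero_of_natDegree_lt (by omega)]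
      · exact (deriv_const x (0 : 𝕜)).symm
      · intro b hb
        have : n ≠ b := by have := Finset.mem_range.1 hb; omega
        simp [this]
  rw [h2]
  exact DifferentiableAt.hasDerivAt (F.coeff n).2

/-- Division by a monic polynomial commutes with ring homomorphisms. So the division is done once
over the ring of functions differentiable at `x`, and evaluation at each `y` recovers the pointwise
quotient. The degree bound `d` is needed to assemble `f` into a single polynomial. -/
theorem PolyHasDerivAt.exists_divByMonic {f g : 𝕜 → 𝕜[X]} {f' g' : 𝕜[X]} {x : 𝕜}
    (hf : PolyHasDerivAt f f' x) (hg : PolyHasDerivAt g g' x) {d N : ℕ}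
    (hd : ∀ y, (f y).natDegree < d) (hm : ∀ y, (g y).Monic) (hN : ∀ y, (g y).natDegree = N) :
    ∃ q, PolyHasDerivAt (fun y => f y /ₘ g y) q x := by
  obtain ⟨A, hA, -⟩ := exists_map_differentiableEval hf hd
  obtain ⟨B, hB, hB'⟩ := exists_map_differentiableEval hg (d := N + 1) (fun y => by rw [hN]; omega)
  have hBm : B.Monic := by
    refine monic_of_natDegree_le_of_coeff_eq_one N ?_ ?_
    · rw [natDegree_le_iff_coeff_eq_zero]
      intro n hn
      ext y
      rw [hB' n]
      exact coeff_eq_zero_of_natDegree_lt (by rw [hN]; exact hn)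
    · ext y
      rw [hB' N]
      have := (hm y).coeff_natDegree
      rw [hN] at this
      exact this
  obtain ⟨q, hq⟩ := exists_polyHasDerivAt_of_map (A /ₘ B)
  refine ⟨q, ?_⟩
  simpa only [map_divByMonic _ hBm, hA, hB] using hq

theorem PolyHasDerivAt.exists_modByMonic {f g : 𝕜 → 𝕜[X]} {f' g' : 𝕜[X]} {x : 𝕜}
    (hf : PolyHasDerivAt f f' x) (hg : PolyHasDerivAt g g' x) {d N : ℕ}
    (hd : ∀ y, (f y).natDegree < d) (hm : ∀ y, (g y).Monic) (hN : ∀ y, (g y).natDegree = N) :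
    ∃ q, PolyHasDerivAt (fun y => f y %ₘ g y) q x := by
  obtain ⟨q, hq⟩ := hf.exists_divByMonic hg hd hm hN
  refine ⟨f' - (g' * (f x /ₘ g x) + g x * q), ?_⟩
  simpa only [modByMonic_eq_sub_mul_div] using hf.sub (hg.mul hq)

end PolynomialCalculus

/-! ### The equation for the derivative of the momentum -/

section EulerLagrange

variable {F : Type*} [Field F]

theorem degree_lt_of_monic_mul {q Y : F[X]} {n N : ℕ} (hq : q.Monic) (hn : q.natDegree = n)
    (h : degree (q * Y) < ((n + N : ℕ) : WithBot ℕ)) : Y.degree < N := by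
  rcases eq_or_ne Y 0 with rfl | h0
  · simp
  rw [Polynomial.degree_mul, degree_eq_natDegree hq.ne_zero, degree_eq_natDegree h0, hn] at h
  rw [degree_eq_natDegree h0]
  norm_cast at h ⊢
  omega

/-- The Euler-Lagrange equation in momentum form. -/
theorem momentum_derivative_eq (h2 : (2 : F) ≠ 0) {N : ℕ} {σ τ ρ P P' D V h₀ h₁ : F[X]}
    (hσ : σ.Monic) (hN : σ.natDegree = N) (hh₀ : h₀.degree < N) (hh₁ : h₁.degree < N)
    (hV : V.degree < N) (hP : X ^ N * τ + P * σ = h₀)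
    (hP' : X ^ N * ρ + P' * σ + P * τ = h₁) (hD : C (1 / 2) * τ ^ 2 = V + σ * D) :
    P' = C (1 / 2) * (P ^ 2 /ₘ X ^ N) + (X ^ N * (D - ρ)) /ₘ σ := by
  have hd : σ.degree = N := by rw [degree_eq_natDegree hσ.ne_zero, hN]
  set A := P ^ 2 /ₘ X ^ N with hA
  set R := P ^ 2 %ₘ X ^ N with hR
  have hRA : R + X ^ N * A = P ^ 2 := modByMonic_add_div _ _
  have hRd : R.degree < N := by
    simpa using degree_modByMonic_lt (P ^ 2) (monic_X_pow (R := F) N)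
  set Θ := (X ^ N * (D - ρ)) /ₘ σ with hΘ
  set h₂ := (X ^ N * (D - ρ)) %ₘ σ with hh₂
  have hΘ' : h₂ + σ * Θ = X ^ N * (D - ρ) := modByMonic_add_div _ _
  have hh₂d : h₂.degree < N := by rw [← hd]; exact degree_modByMonic_lt _ hσ
  have hhalf : (C (1 / 2) : F[X]) * 2 = 1 := by
    rw [← C_ofNat, ← C_mul, one_div, inv_mul_cancel₀ h2, C_1]
  set κ : F[X] := C (1 / 2) with hκ
  -- Claim: `Y` has degree below `N`. Multiplied by `X^N σ` it becomes a combination of `V`, `h₀`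
  -- and `R` of degree below `3N`, because the large terms complete the square `(X^N τ + P σ)²`.
  -- Then `σ` times the defect of the asserted formula also has degree below `N`, so the defect is
  -- zero.
  set Y := P * τ + X ^ N * D + κ * σ * A with hY
  have e1 : σ * (P' - (κ * A + Θ)) = -Y + (h₁ + h₂) := by
    rw [hY]
    linear_combination hP' - hΘ'
  have e2 : (X ^ N * σ) * Y = V * -(X ^ N * X ^ N) + (h₀ * (κ * h₀) + R * -(κ * σ ^ 2)) := by
    rw [hY]
    linear_combination (-(X : F[X]) ^ N * X ^ N) * hD + κ * σ ^ 2 * hRA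
      + κ * (X ^ N * τ + P * σ + h₀) * hP - (X ^ N * τ * (P * σ)) * hhalf
  have hYd : Y.degree < N := by
    refine degree_lt_of_monic_mul (n := N + N) ((monic_X_pow N).mul hσ) ?_ ?_
    · rw [(monic_X_pow N).natDegree_mul hσ, natDegree_X_pow, hN]
    · rw [e2]
      have d1 : degree (V * -(X ^ N * X ^ N)) < ((N + (N + N) : ℕ) : WithBot ℕ) :=
        degree_mul_lt_of_lt hV (by rw [degree_neg, ← pow_add, degree_X_pow])
      have d2 : degree (h₀ * (κ * h₀)) < ((N + N : ℕ) : WithBot ℕ) :=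
        degree_mul_lt_of_lt hh₀ (by
          rw [hκ, ← smul_eq_C_mul]; exact (degree_smul_le _ _).trans hh₀.le)
      have d3 : degree (R * -(κ * σ ^ 2)) < ((N + (N + N) : ℕ) : WithBot ℕ) :=
        degree_mul_lt_of_lt hRd (by
          rw [degree_neg, hκ, ← smul_eq_C_mul]
          refine (degree_smul_le _ _).trans ?_
          rw [pow_two, Polynomial.degree_mul, hd]
          exact le_rfl)
      have e3 : N + N + N = N + (N + N) := by ring
      rw [e3]
      refine (degree_add_le _ _).trans_lt (max_lt d1 ((degree_add_le _ _).trans_lt (max_lt ?_ d3)))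
      exact d2.trans_le (by exact_mod_cast Nat.le_add_left _ _)
  have h0 : P' - (κ * A + Θ) = 0 := by
    rw [← degree_eq_bot]
    refine Nat.WithBot.lt_zero_iff.1 ?_
    have := degree_lt_of_monic_mul (Y := P' - (κ * A + Θ)) (N := 0) hσ hN ?_
    · exact_mod_cast this
    · rw [e1]
      refine (degree_add_le _ _).trans_lt (max_lt (by rw [degree_neg]; exact hYd)
        ((degree_add_le _ _).trans_lt (max_lt hh₁ hh₂d)))
  exact sub_eq_zero.1 h0

theorem dvd_of_dvd_linear_mul {σ q : F[X]} {m₁ μ₀ : F} (hm : m₁ ≠ 0) (h0 : σ.eval μ₀ ≠ 0)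
    (h : σ ∣ C m₁ * (X - C μ₀) * q) : σ ∣ q := by
  have h1 : IsCoprime (X - C μ₀) σ :=
    (irreducible_X_sub_C μ₀).coprime_iff_not_dvd.2 fun hd => h0 (dvd_iff_isRoot.1 hd)
  rw [mul_assoc] at h
  exact h1.symm.dvd_of_dvd_mul_left (((isUnit_C.2 hm.isUnit).dvd_mul_left).1 h)

end EulerLagrange

/-! ### The gradient of the first potential -/

section Potential

variable {𝕜 : Type*} [NontriviallyNormedField 𝕜] {N : ℕ}

theorem coordPoly_update (w : Fin N → 𝕜) (i : Fin N) (s : 𝕜) :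
    coordPoly (Function.update w i s) = coordPoly w + C (s - w i) * X ^ (N - 1 - i.val) := by
  have h : Function.update w i s = w + Pi.single i (s - w i) := by
    funext j
    rcases eq_or_ne j i with rfl | hj
    · simp
    · simp [hj]
  rw [h, coordPoly, coordPoly]
  simp only [Pi.add_apply, C_add, add_mul, Finset.sum_add_distrib]
  congr 1
  rw [Finset.sum_eq_single i]
  · simp
  · intro b _ hb
    simp [hb]
  · simp

theorem sigma_update (w : Fin N → 𝕜) (i : Fin N) (s : 𝕜) :
    sigma (Function.update w i s) = sigma w + C (s - w i) * X ^ (N - 1 - i.val) := by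
  rw [sigma_eq, sigma_eq, coordPoly_update, add_assoc]

/-- Differentiate `c = mV + σB` in `w_i`, where `σ` varies by `X^n`: `0 = mV' + X^n B + σB'`. Modulo
`σ` the cofactor `B = σG + mE` becomes `mE`, and `m` is invertible there, so `V' ≡ -X^n E`. -/
theorem hasDerivAt_potential {c G E V : 𝕜[X]} {m₁ μ₀ : 𝕜} {w : Fin N → 𝕜} (hN : 0 < N)
    (hm : m₁ ≠ 0) (h0 : (sigma w).eval μ₀ ≠ 0) (hV : V.degree < N)
    (hc : c = C m₁ * (X - C μ₀) * V + sigma w * (sigma w * G + C m₁ * (X - C μ₀) * E))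
    (i : Fin N) :
    HasDerivAt (fun s => potential (C m₁ * (X - C μ₀)) c ⟨0, hN⟩ (Function.update w i s))
      (-((X ^ (N - 1 - i.val) * E) %ₘ sigma w).coeff (N - 1)) (w i) := by
  set m := C m₁ * (X - C μ₀) with hmdef
  set σ : 𝕜 → 𝕜[X] := fun s => sigma (Function.update w i s) with hσdef
  set n := N - 1 - i.val with hn
  have hσw : σ (w i) = sigma w := by rw [hσdef]; simp
  have hσeq : ∀ s, σ s = sigma w + C (s - w i) * X ^ n := fun s => sigma_update w i s
  have hσm : ∀ s, (σ s).Monic := fun s => sigma_monic _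
  have hσN : ∀ s, (σ s).natDegree = N := fun s => natDegree_sigma _
  have hσd : PolyHasDerivAt σ (X ^ n) (w i) := by
    have h1 := (PolyHasDerivAt.const (sigma w) (w i)).add
      ((PolyHasDerivAt.C ((hasDerivAt_id (w i)).sub_const (w i))).mul
        (PolyHasDerivAt.const (X ^ n) (w i)))
    rw [funext hσeq]
    simpa using h1
  have heval : HasDerivAt (fun s => (σ s).eval μ₀) (μ₀ ^ n) (w i) := by
    have h1 := (((hasDerivAt_id (w i)).sub_const (w i)).mul_const (μ₀ ^ n)).const_add
      ((sigma w).eval μ₀)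
    simpa [hσeq] using h1
  have h0' : (σ (w i)).eval μ₀ ≠ 0 := by rwa [hσw]
  -- `κ` makes `c - κσ` vanish at `μ₀`, hence divisible by `m` with quotient `W`; the potential
  -- polynomial is `W mod σ`. This explicit formula shows that it is differentiable in `s`.
  set κ : 𝕜 → 𝕜 := fun s => c.eval μ₀ / (σ s).eval μ₀ with hκ
  obtain ⟨κ', hκ'⟩ : ∃ κ', HasDerivAt κ κ' (w i) :=
    ⟨_, (hasDerivAt_const (w i) (c.eval μ₀)).fun_div heval h0'⟩
  set W : 𝕜 → 𝕜[X] := fun s => C m₁⁻¹ * ((c - C (κ s) * σ s) /ₘ (X - C μ₀)) with hW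
  have hcd : ∀ s, (c - C (κ s) * σ s).natDegree < max c.natDegree N + 1 := by
    intro s
    refine Nat.lt_succ_of_le ((natDegree_sub_le _ _).trans (max_le_max le_rfl ?_))
    exact (natDegree_C_mul_le _ _).trans (hσN s).le
  obtain ⟨q₁, hq₁⟩ := ((PolyHasDerivAt.const c (w i)).sub
    ((PolyHasDerivAt.C hκ').mul hσd)).exists_divByMonic
      (PolyHasDerivAt.const (X - C μ₀) (w i)) hcd (fun _ => monic_X_sub_C μ₀)
      (fun _ => natDegree_X_sub_C μ₀)
  have hWd : PolyHasDerivAt W (C m₁⁻¹ * q₁) (w i) := hq₁.const_mul _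
  have hWdeg : ∀ s, (W s).natDegree < max c.natDegree N + 1 := fun s =>
    lt_of_le_of_lt ((natDegree_C_mul_le _ _).trans (by
      rw [natDegree_divByMonic _ (monic_X_sub_C μ₀)]; exact Nat.sub_le _ _)) (hcd s)
  obtain ⟨B', hB'⟩ := hWd.exists_divByMonic hσd hWdeg hσm hσN
  obtain ⟨V', hV'⟩ := hWd.exists_modByMonic hσd hWdeg hσm hσN
  have hVdeg : ∀ s, (W s %ₘ σ s).degree < N := fun s => by
    have h1 : (σ s).degree = N := degree_sigma _
    rw [← h1]
    exact degree_modByMonic_lt _ (hσm s)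
  have hne : ∀ᶠ s in 𝓝 (w i), (σ s).eval μ₀ ≠ 0 := heval.continuousAt.eventually_ne h0'
  have hmW : ∀ s, (σ s).eval μ₀ ≠ 0 → m * W s = c - C (κ s) * σ s := by
    intro s hs
    have h1 := modByMonic_add_div (c - C (κ s) * σ s) (X - C μ₀)
    rw [modByMonic_X_sub_C_eq_C_eval] at h1
    have h2 : (c - C (κ s) * σ s).eval μ₀ = 0 := by
      simp [hκ, div_mul_cancel₀ _ hs]
    rw [h2, C_0, zero_add] at h1
    have h3 : (C m₁ : 𝕜[X]) * C m₁⁻¹ = 1 := by rw [← C_mul, mul_inv_cancel₀ hm, C_1]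
    rw [hmdef, hW]
    linear_combination h1 + ((X - C μ₀) * ((c - C (κ s) * σ s) /ₘ (X - C μ₀))) * h3
  have hdecomp : ∀ s, (σ s).eval μ₀ ≠ 0 →
      c = m * (W s %ₘ σ s) + σ s * (C (κ s) + m * (W s /ₘ σ s)) := by
    intro s hs
    have h1 := hmW s hs
    have h2 := modByMonic_add_div (W s) (σ s)
    linear_combination -h1 - m * h2
  have hpot : (fun s => potential m c ⟨0, hN⟩ (Function.update w i s))
      =ᶠ[𝓝 (w i)] fun s => (W s %ₘ σ s).coeff (N - 1) := by
    filter_upwards [hne] with s hs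
    exact potential_eq_coeff (isUnit_aeval_of_eval_ne_zero hs hm) (hVdeg s) (hdecomp s hs) _
  have hdiff := (hV'.const_mul m).add (hσd.mul ((PolyHasDerivAt.C hκ').add (hB'.const_mul m)))
  have hzero := hdiff.unique (PolyHasDerivAt.const c (w i)) (by
    filter_upwards [hne] with s hs
    exact (hdecomp s hs).symm)
  -- Since `m` is prime to `σ`, the reduced `V` and its cofactor are unique, so the explicit
  -- decomposition is the given one.
  have hVeq : W (w i) %ₘ σ (w i) = V ∧
      C (κ (w i)) + m * (W (w i) /ₘ σ (w i)) = sigma w * G + m * E := by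
    have h1 := hdecomp _ h0'
    rw [hσw] at h1 ⊢
    have h2 : sigma w ∣ m * (W (w i) %ₘ sigma w - V) :=
      ⟨sigma w * G + m * E - (C (κ (w i)) + m * (W (w i) /ₘ sigma w)), by
        linear_combination hc - h1⟩
    have h3 := dvd_of_dvd_linear_mul hm h0 h2
    have hVd := hVdeg (w i)
    rw [hσw] at hVd
    have h4 : W (w i) %ₘ sigma w - V = 0 := by
      refine eq_zero_of_dvd_of_degree_lt h3 ?_
      rw [degree_sigma]
      exact (degree_sub_le _ _).trans_lt (max_lt hVd hV)
    have h5 : W (w i) %ₘ sigma w = V := sub_eq_zero.1 h4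
    refine ⟨h5, ?_⟩
    rw [h5] at h1
    exact mul_left_cancel₀ (sigma_monic w).ne_zero (by linear_combination hc - h1)
  have hV'eq : V' = -((X ^ n * E) %ₘ sigma w) := by
    rw [hVeq.2, hσw] at hzero
    have h1 : sigma w ∣ m * (V' + X ^ n * E) :=
      ⟨-(X ^ n * G + (C κ' + m * B')), by linear_combination hzero⟩
    have h2 := dvd_of_dvd_linear_mul hm h0 h1
    obtain ⟨t, ht⟩ := h2
    have h3 := (div_modByMonic_unique (f := -(X ^ n * E)) (-t) V' (sigma_monic w)
      ⟨by linear_combination ht, by rw [degree_sigma]; exact hV'.degree_lt hVdeg⟩).2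
    rw [← h3, neg_modByMonic]
  have h1 := hV' (N - 1)
  rw [hV'eq, coeff_neg] at h1
  exact h1.congr_of_eventuallyEq hpot

end Potential

/-! ### The gradient of the first kinetic energy -/

section Kinetic

variable {𝕜 : Type*} [RCLike 𝕜] {N : ℕ}

theorem deriv_kinetic_momentum (hN : 0 < N) (w p : Fin N → 𝕜) (i : Fin N) :
    HasDerivAt (fun s => kinetic ⟨0, hN⟩ w (Function.update p i s))
      (-(invMetric w).mulVec p i) (p i) := by
  simp only [kinetic_zero]
  have hu : ∀ j, HasDerivAt (fun s => Function.update p i s j) ((Pi.single i 1 : Fin N → 𝕜) j)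
      (p i) := fun j => hasDerivAt_pi.1 (hasDerivAt_update p i (p i)) j
  have h1 : ∀ a b, HasDerivAt (fun s => Function.update p i s a * invMetric w a b
      * Function.update p i s b) ((Pi.single i 1 : Fin N → 𝕜) a * invMetric w a b * p b
        + p a * invMetric w a b * (Pi.single i 1 : Fin N → 𝕜) b) (p i) := by
    intro a b
    have := ((hu a).mul_const (invMetric w a b)).fun_mul (hu b)
    simpa using this
  have h2 := ((HasDerivAt.fun_sum (u := Finset.univ) fun a _ =>
    HasDerivAt.fun_sum (u := Finset.univ) fun b _ => h1 a b).const_mul (1 / 2)).fun_neg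
  refine h2.congr_deriv ?_
  simp only [Finset.sum_add_distrib, Pi.single_apply, ite_mul, one_mul, zero_mul, mul_ite, mul_one,
    mul_zero, Finset.sum_ite_irrel, Finset.sum_const_zero, Finset.sum_ite_eq',
    Finset.mem_univ, if_true]
  have h3 : ∑ a, p a * invMetric w a i = ∑ b, invMetric w i b * p b :=
    Finset.sum_congr rfl fun a _ => by rw [invMetric_symm, mul_comm]
  rw [h3, Matrix.mulVec, dotProduct]
  ring

/-- The coordinate `w_i` occupies the antidiagonal `a + b = N + i` of `g⁻¹`, so its derivative
collects exactly the products `p_a p_b` forming the coefficient of `X^(N+i)` in the square of the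
momentum polynomial. -/
theorem deriv_kinetic_position (hN : 0 < N) (w p : Fin N → 𝕜) (i : Fin N) :
    HasDerivAt (fun s => kinetic ⟨0, hN⟩ (Function.update w i s) p)
      (-(1 / 2 * (momentumPoly p ^ 2).coeff (N + i.val))) (w i) := by
  simp only [kinetic_zero]
  have h1 : ∀ a b : Fin N, HasDerivAt (fun s => p a * invMetric (Function.update w i s) a b * p b)
      (p a * (if a.val + b.val = N + i.val then 1 else 0) * p b) (w i) := by
    intro a b
    refine HasDerivAt.mul_const (HasDerivAt.const_mul _ ?_) _
    simp only [invMetric_apply, sigma_update, coeff_add, coeff_C_mul, coeff_X_pow]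
    have e : (2 * N - 1 - a.val - b.val = N - 1 - i.val) ↔ (a.val + b.val = N + i.val) := by omega
    simp only [e]
    simpa using (((hasDerivAt_id (w i)).sub_const (w i)).mul_const
      (if a.val + b.val = N + i.val then (1 : 𝕜) else 0)).const_add
        ((sigma w).coeff (2 * N - 1 - a.val - b.val))
  have h2 := ((HasDerivAt.fun_sum (u := Finset.univ) fun a _ =>
    HasDerivAt.fun_sum (u := Finset.univ) fun b _ => h1 a b).const_mul (1 / 2)).fun_neg
  refine h2.congr_deriv ?_
  rw [pow_two]
  simp only [momentumPoly, Finset.sum_mul_sum, finsetSum_coeff]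
  congr 2
  refine Finset.sum_congr rfl fun a _ => Finset.sum_congr rfl fun b _ => ?_
  have e : C (p a) * X ^ a.val * (C (p b) * X ^ b.val)
      = C (p a * p b) * (X : 𝕜[X]) ^ (a.val + b.val) := by
    rw [C_mul, pow_add]; ring
  rw [e, coeff_C_mul, coeff_X_pow]
  simp only [eq_comm (a := N + i.val)]
  ring

end Kinetic

/-! ### From a profile to a finite-gap solution -/

section Profile

variable {𝕜 : Type*} [RCLike 𝕜] {N : ℕ}

theorem coeff_divByMonic_X_pow {F : Type*} [Field F] (P : F[X]) (N i : ℕ) :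
    (P /ₘ X ^ N).coeff i = P.coeff (i + N) := by
  have h1 := modByMonic_add_div P (X ^ N)
  have h2 : (P %ₘ X ^ N).degree < N := by
    simpa using degree_modByMonic_lt P (monic_X_pow (R := F) N)
  have h3 : (P %ₘ X ^ N).coeff (i + N) = 0 :=
    coeff_eq_zero_of_degree_lt (h2.trans_le (by exact_mod_cast Nat.le_add_left N i))
  have h4 := congrArg (fun q => coeff q (i + N)) h1
  simpa [h3, coeff_X_pow_mul] using h4

theorem PolyHasDerivAt.exists_momentumOf {σ τ : 𝕜 → 𝕜[X]} {σ' τ' : 𝕜[X]} {x : 𝕜}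
    (hσd : PolyHasDerivAt σ σ' x) (hτd : PolyHasDerivAt τ τ' x)
    (hσ : ∀ y, (σ y).Monic) (hN : ∀ y, (σ y).natDegree = N) (hτ : ∀ y, (τ y).degree < N) :
    ∃ P', PolyHasDerivAt (fun y => momentumOf N (σ y) (τ y)) P' x := by
  have hdeg : ∀ y, (X ^ N * τ y).natDegree < N + N + 1 := fun y => by
    refine Nat.lt_succ_of_le (natDegree_mul_le.trans (add_le_add (natDegree_X_pow_le N) ?_))
    exact natDegree_le_of_degree_le (hτ y).le
  obtain ⟨q, hq⟩ := (hτd.const_mul (X ^ N)).exists_divByMonic hσd hdeg hσ hN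
  exact ⟨-q, hq.neg⟩

theorem const_of_polyHasDerivAt_zero {f : 𝕜 → 𝕜[X]}
    (h : ∀ᶠ x in 𝓝 (0 : 𝕜), PolyHasDerivAt f 0 x) : ∀ᶠ x in 𝓝 (0 : 𝕜), f x = f 0 := by
  obtain ⟨r, hr, hb⟩ := Metric.eventually_nhds_iff_ball.1 h
  filter_upwards [Metric.ball_mem_nhds (0 : 𝕜) hr] with x hx
  ext n
  have hc : IsPreconnected (Metric.ball (0 : 𝕜) r) := by
    let _ : NormedSpace ℝ 𝕜 := NormedSpace.restrictScalars ℝ 𝕜 𝕜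
    exact (convex_ball (0 : 𝕜) r).isPreconnected
  refine Metric.isOpen_ball.is_const_of_deriv_eq_zero (f := fun y => (f y).coeff n) hc ?_ ?_ hx
    (Metric.mem_ball_self hr)
  · exact fun y hy => ((hb y hy) n).differentiableAt.differentiableWithinAt
  · exact fun y hy => by simpa using ((hb y hy) n).deriv

/-- The polynomial `c` attached to a profile. -/
def energyPoly (m : 𝕜[X]) (u : 𝕜) (σ τ ρ : 𝕜[X]) : 𝕜[X] :=
  (X + C u) * σ ^ 2 + m * (C (1 / 2) * τ ^ 2 - σ * ρ)

/-- The term `(X + u)σ²` supplies the leading coefficient and `u + 2σ_{N-1}` below it; `mσρ`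
contributes `m₁ρ_{N-1}`, and `mτ²` has too small a degree to reach `2N`. -/
theorem energyPoly_monic_and_coeff {m₁ μ₀ : 𝕜} (u : 𝕜) {σ τ ρ : 𝕜[X]} (hpos : 0 < N)
    (hσ : σ.Monic) (hN : σ.natDegree = N) (hτ : τ.degree < N) (hρ : ρ.degree < N) :
    (energyPoly (C m₁ * (X - C μ₀)) u σ τ ρ).Monic ∧
    (energyPoly (C m₁ * (X - C μ₀)) u σ τ ρ).natDegree = 2 * N + 1 ∧
    (energyPoly (C m₁ * (X - C μ₀)) u σ τ ρ).coeff (2 * N)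
      = u + 2 * σ.coeff (N - 1) - m₁ * ρ.coeff (N - 1) := by
  obtain ⟨n, rfl⟩ : ∃ n, N = n + 1 := ⟨N - 1, by omega⟩
  have hτ' : τ.natDegree ≤ n := by
    rw [natDegree_le_iff_degree_le]
    exact Order.lt_succ_iff.1 hτ
  have hρ' : ρ.natDegree ≤ n := by
    rw [natDegree_le_iff_degree_le]
    exact Order.lt_succ_iff.1 hρ
  set A := (X + C u) * σ ^ 2 with hA
  set Q := C (1 / 2) * τ ^ 2 - σ * ρ with hQ
  have hAm : A.Monic := (monic_X_add_C u).mul (hσ.pow 2)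
  have hAd : A.natDegree = 2 * (n + 1) + 1 := by
    rw [hA, (monic_X_add_C u).natDegree_mul (hσ.pow 2), hσ.natDegree_pow, natDegree_X_add_C, hN]
    ring
  have hτ2 : (C (1 / 2) * τ ^ 2).natDegree ≤ 2 * n := by
    refine (natDegree_C_mul_le _ _).trans (natDegree_pow_le.trans ?_)
    exact Nat.mul_le_mul le_rfl hτ'
  have hσρ : (σ * ρ).natDegree ≤ n + 1 + n := natDegree_mul_le.trans (add_le_add hN.le hρ')
  have hQd : Q.natDegree ≤ n + 1 + n :=
    (natDegree_sub_le _ _).trans (max_le (hτ2.trans (by omega)) hσρ)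
  have hQc : Q.coeff (n + 1 + n) = -ρ.coeff n := by
    have h1 : (σ * ρ).coeff (n + 1 + n) = ρ.coeff n := by
      rw [coeff_mul_add_eq_of_natDegree_le hN.le hρ', ← hN, hσ.coeff_natDegree, one_mul]
    rw [hQ, coeff_sub, h1, coeff_eq_zero_of_natDegree_lt (lt_of_le_of_lt hτ2 (by omega)), zero_sub]
  have hmd : (C m₁ * (X - C μ₀)).natDegree ≤ 1 :=
    (natDegree_C_mul_le _ _).trans (natDegree_X_sub_C μ₀).le
  have hmc : (C m₁ * (X - C μ₀)).coeff 1 = m₁ := by simp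
  have hmQd : (C m₁ * (X - C μ₀) * Q).natDegree ≤ 1 + (n + 1 + n) :=
    natDegree_mul_le.trans (add_le_add hmd hQd)
  have hmQc : (C m₁ * (X - C μ₀) * Q).coeff (1 + (n + 1 + n)) = -(m₁ * ρ.coeff n) := by
    rw [coeff_mul_add_eq_of_natDegree_le hmd hQd, hmc, hQc, mul_neg]
  have hlt : (C m₁ * (X - C μ₀) * Q).degree < A.degree := by
    rw [degree_eq_natDegree hAm.ne_zero, hAd]
    refine (natDegree_le_iff_degree_le.1 hmQd).trans_lt ?_
    exact_mod_cast (by omega : 1 + (n + 1 + n) < 2 * (n + 1) + 1)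
  refine ⟨hAm.add_of_left hlt, ?_, ?_⟩
  · exact (natDegree_add_eq_left_of_degree_lt hlt).trans hAd
  · rw [energyPoly, coeff_add]
    have e : 1 + (n + 1 + n) = 2 * (n + 1) := by ring
    rw [e] at hmQc
    rw [hmQc]
    have hnext : A.nextCoeff = u + 2 * σ.coeff n := by
      rw [hA, (monic_X_add_C u).nextCoeff_mul (hσ.pow 2), hσ.nextCoeff_pow, nextCoeff_X_add_C,
        nextCoeff_of_natDegree_pos (by omega : 0 < σ.natDegree), hN]
      simp
    rw [nextCoeff_of_natDegree_pos (by omega), hAd] at hnext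
    simp only [Nat.add_sub_cancel] at hnext ⊢
    rw [hnext]
    ring

/-- The equations for `w` are the Legendre relation. For `p`, split `½τ² = V + σD`; then `c = mV +
σ(σ(X + u) + m(D - ρ))`, which is the shape required by `hasDerivAt_potential`. Both gradients are
then coefficients of the two summands in `momentum_derivative_eq`. -/
theorem hamiltonEquationsAt_of_profile {m₁ μ₀ : 𝕜} (hpos : 0 < N) (hm : m₁ ≠ 0)
    {σ τ : 𝕜 → 𝕜[X]} {ρ c : 𝕜[X]} {u x : 𝕜}
    (hσ : ∀ y, (σ y).Monic) (hN : ∀ y, (σ y).natDegree = N) (hτ : ∀ y, (τ y).degree < N)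
    (hσd : PolyHasDerivAt σ (τ x) x) (hτd : PolyHasDerivAt τ ρ x)
    (h0 : (σ x).eval μ₀ ≠ 0)
    (hc : c = energyPoly (C m₁ * (X - C μ₀)) u (σ x) (τ x) ρ) :
    HamiltonEquationsAt (hamiltonian (C m₁ * (X - C μ₀)) c ⟨0, hpos⟩)
      (fun y (i : Fin N) => (σ y).coeff (N - 1 - i.val))
      (fun y (i : Fin N) => (momentumOf N (σ y) (τ y)).coeff i.val) x := by
  intro i
  have hsig : sigma (fun i : Fin N => (σ x).coeff (N - 1 - i.val)) = σ x :=
    sigma_of_coeff (hσ x) (hN x)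
  have hd : (σ x).degree = N := by rw [degree_eq_natDegree (hσ x).ne_zero, hN]
  set w : Fin N → 𝕜 := fun i => (σ x).coeff (N - 1 - i.val) with hw
  set p : Fin N → 𝕜 := fun i => (momentumOf N (σ x) (τ x)).coeff i.val with hp
  constructor
  · have h1 := (deriv_kinetic_momentum hpos w p i).add_const
      (potential (C m₁ * (X - C μ₀)) c ⟨0, hpos⟩ w)
    have h2 : deriv (fun s => hamiltonian (C m₁ * (X - C μ₀)) c ⟨0, hpos⟩ w
        (Function.update p i s)) (p i) = (τ x).coeff (N - 1 - i.val) := by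
      have h3 := invMetric_mulVec_momentumOf w (hτ x) i
      rw [hsig] at h3
      rw [← neg_eq_iff_eq_neg] at h3
      rw [← h3]
      exact h1.deriv
    simp only
    rw [h2]
    exact hσd _
  · obtain ⟨P', hP'⟩ := hσd.exists_momentumOf hτd hσ hN hτ
    set V := (C (1 / 2) * τ x ^ 2) %ₘ σ x with hV
    set D := (C (1 / 2) * τ x ^ 2) /ₘ σ x with hD
    have hVD : V + σ x * D = C (1 / 2) * τ x ^ 2 := modByMonic_add_div _ _
    have hVd : V.degree < N := by rw [← hd]; exact degree_modByMonic_lt _ (hσ x)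
    have hc' : c = C m₁ * (X - C μ₀) * V
        + sigma w * (sigma w * (X + C u) + C m₁ * (X - C μ₀) * (D - ρ)) := by
      rw [hc, energyPoly, hsig]
      linear_combination (-(C m₁ * (X - C μ₀))) * hVD
    have h1 := (deriv_kinetic_position hpos w p i).add
      (hasDerivAt_potential hpos hm (by rwa [hsig]) hVd hc' i)
    have hrem : ∀ y, degree (X ^ N * τ y + momentumOf N (σ y) (τ y) * σ y) < (N : WithBot ℕ) := by
      intro y
      rw [momentumOf_spec]
      have : (σ y).degree = N := by rw [degree_eq_natDegree (hσ y).ne_zero, hN]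
      rw [← this]
      exact degree_modByMonic_lt _ (hσ y)
    have hrem' := ((hτd.const_mul (X ^ N)).add (hP'.mul hσd)).degree_lt hrem
    have hEL := momentum_derivative_eq (ρ := ρ) (P' := P') (two_ne_zero' 𝕜) (hσ x) (hN x) (hrem x) hrem' hVd rfl
      (by ring) hVD.symm
    have h2 : P'.coeff i.val = -(-(1 / 2 * (momentumPoly p ^ 2).coeff (N + i.val))
        + -((X ^ (N - 1 - i.val) * (D - ρ)) %ₘ sigma w).coeff (N - 1)) := by
      have hmom : momentumPoly p = momentumOf N (σ x) (τ x) :=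
        momentumPoly_coeff _ (degree_momentumOf_lt (hσ x) (hN x) (hτ x))
      rw [hEL, coeff_add, coeff_C_mul, coeff_divByMonic_X_pow_mul (hσ x) (hN x) _ i.isLt, hsig,
        hmom, coeff_divByMonic_X_pow]
      rw [add_comm i.val N]
      ring
    have h3 : deriv (fun s => hamiltonian (C m₁ * (X - C μ₀)) c ⟨0, hpos⟩
        (Function.update w i s) p) (w i) = _ := h1.deriv
    simp only
    rw [h3, ← h2]
    exact hP' _

/-- The equation `hode` makes `energyPoly` constant in `x`. With one `c` valid at all nearby points,
level, flow and reduction follow from pointwise identities. -/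
theorem isFiniteGapSolution_of_profile {m₁ μ₀ : 𝕜} (hpos : 0 < N) (hm : m₁ ≠ 0)
    (lam : OnePoint 𝕜) {σ τ ρ ρ' : 𝕜 → 𝕜[X]} {u u' : 𝕜 → 𝕜}
    (hσ : ∀ y, (σ y).Monic) (hN : ∀ y, (σ y).natDegree = N) (hτ : ∀ y, (τ y).degree < N)
    (hρ : ∀ y, (ρ y).degree < N)
    (hσd : ∀ᶠ x in 𝓝 (0 : 𝕜), PolyHasDerivAt σ (τ x) x)
    (hτd : ∀ᶠ x in 𝓝 (0 : 𝕜), PolyHasDerivAt τ (ρ x) x)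
    (hρd : ∀ᶠ x in 𝓝 (0 : 𝕜), PolyHasDerivAt ρ (ρ' x) x)
    (hud : ∀ᶠ x in 𝓝 (0 : 𝕜), HasDerivAt u (u' x) x)
    (h0 : ∀ᶠ x in 𝓝 (0 : 𝕜), (σ x).eval μ₀ ≠ 0)
    (hode : ∀ᶠ x in 𝓝 (0 : 𝕜), C m₁ * (X - C μ₀) * ρ' x
      = C (u' x) * σ x + 2 * (X + C (u x)) * τ x)
    (hnorm : u 0 + 2 * (σ 0).coeff (N - 1) - m₁ * (ρ 0).coeff (N - 1) = 0)
    (hspeed : ∀ l : 𝕜, lam = (l : OnePoint 𝕜) → ∃ a : 𝕜, a ≠ 0 ∧ a ^ 2 =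
      (energyPoly (C m₁ * (X - C μ₀)) (u 0) (σ 0) (τ 0) (ρ 0)).eval l) :
    IsFiniteGapSolution (C m₁ * (X - C μ₀)) lam
      (energyPoly (C m₁ * (X - C μ₀)) (u 0) (σ 0) (τ 0) (ρ 0))
      (fun y (i : Fin N) => (σ y).coeff (N - 1 - i.val))
      (fun y (i : Fin N) => (momentumOf N (σ y) (τ y)).coeff i.val)
      (fun y (_ : Fin 1) => u y) := by
  set m := C m₁ * (X - C μ₀) with hmdef
  have hsig : ∀ x, sigma (fun i : Fin N => (σ x).coeff (N - 1 - i.val)) = σ x := fun x =>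
    sigma_of_coeff (hσ x) (hN x)
  have hconst : ∀ᶠ x in 𝓝 (0 : 𝕜), energyPoly m (u x) (σ x) (τ x) (ρ x)
      = energyPoly m (u 0) (σ 0) (τ 0) (ρ 0) := by
    refine const_of_polyHasDerivAt_zero (f := fun x => energyPoly m (u x) (σ x) (τ x) (ρ x)) ?_
    filter_upwards [hσd, hτd, hρd, hud, hode] with x h1 h2 h3 h4 h5
    have hX := (PolyHasDerivAt.const (X : 𝕜[X]) x).add (PolyHasDerivAt.C h4)
    have h6 := (hX.mul (h1.mul h1)).add
      (((PolyHasDerivAt.const_mul (C (1 / 2)) (h2.mul h2)).sub (h1.mul h3)).const_mul m)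
    have hhalf : (C (1 / 2) : 𝕜[X]) * 2 = 1 := by
      rw [← C_ofNat, ← C_mul, one_div, inv_mul_cancel₀ two_ne_zero, C_1]
    simp only [energyPoly, pow_two]
    convert h6 using 1
    linear_combination (σ x) * h5 - m * τ x * ρ x * hhalf
  obtain ⟨hc1, hc2, hc3⟩ := energyPoly_monic_and_coeff (m₁ := m₁) (μ₀ := μ₀) (u 0) hpos (hσ 0)
    (hN 0) (hτ 0) (hρ 0)
  refine ⟨hpos, hc1, hc2, ?_, hspeed, ?_, ?_, ?_, ?_⟩
  · rw [Nat.add_sub_cancel]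
    exact hc3.trans hnorm
  · intro i
    have h0' := h0.self_of_nhds
    have hd : (σ 0).degree = N := by rw [degree_eq_natDegree (hσ 0).ne_zero, hN]
    have hk := kineticPoly_momentumOf (fun i : Fin N => (σ 0).coeff (N - 1 - i.val)) (hτ 0)
    have hhalf : C (1 / 2) * (τ 0 ^ 2 %ₘ σ 0) = (C (1 / 2) * τ 0 ^ 2) %ₘ σ 0 := by
      rw [← smul_eq_C_mul, ← smul_eq_C_mul, smul_modByMonic]
    rw [hsig, hhalf] at hk
    have hVd : ((C (1 / 2) * τ 0 ^ 2) %ₘ σ 0).degree < N := by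
      rw [← hd]; exact degree_modByMonic_lt _ (hσ 0)
    have hp := potential_eq_coeff (m := m) (c := energyPoly m (u 0) (σ 0) (τ 0) (ρ 0))
      (V := (C (1 / 2) * τ 0 ^ 2) %ₘ σ 0)
      (B := (X + C (u 0)) * σ 0 + m * ((C (1 / 2) * τ 0 ^ 2) /ₘ σ 0 - ρ 0))
      (w := fun i : Fin N => (σ 0).coeff (N - 1 - i.val))
      (isUnit_aeval_of_eval_ne_zero (by rwa [hsig]) hm) hVd (by
        have h1 := modByMonic_add_div (C (1 / 2) * τ 0 ^ 2) (σ 0)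
        rw [hsig, energyPoly]
        linear_combination (-m) * h1) i
    rw [hamiltonian, hp, kinetic, hk, coeff_neg]
    exact neg_add_cancel _
  · filter_upwards [h0] with x hx
    exact isUnit_aeval_of_eval_ne_zero (by rwa [hsig]) hm
  · filter_upwards [hconst, hσd, hτd, h0] with x h1 h2 h3 h4
    exact hamiltonEquationsAt_of_profile hpos hm hσ hN hτ h2 h3 h4 h1.symm
  · filter_upwards [hconst] with x hx
    -- The quotient `r` is read off from the formula for `c`; its degree is below `2N` because `τ`
    -- and `ρ` have degree below `N`.
    refine ⟨σ x * ρ x - C (1 / 2) * τ x ^ 2, ?_, ?_⟩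
    · rw [hsig, sigma_one, ← hx, energyPoly]
      ring
    · have hd : (σ x).degree = N := by rw [degree_eq_natDegree (hσ x).ne_zero, hN]
      have d1 : degree (ρ x * σ x) < ((N + N : ℕ) : WithBot ℕ) := degree_mul_lt_of_lt (hρ x) hd.le
      have d2 : degree (τ x * (C (1 / 2) * τ x)) < ((N + N : ℕ) : WithBot ℕ) :=
        degree_mul_lt_of_lt (hτ x) (by
          rw [← smul_eq_C_mul]; exact (degree_smul_le _ _).trans (hτ x).le)
      have e : σ x * ρ x - C (1 / 2) * τ x ^ 2 = ρ x * σ x - τ x * (C (1 / 2) * τ x) := by ring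
      rw [e, two_mul]
      exact (degree_sub_le _ _).trans_lt (max_lt d1 d2)

end Profile

/-! ### Formal initial value problems -/

section FormalODE

variable {K : Type*} [Field K]

/-- Two power series agree up to order `n`. -/
def AgreeTo (n : ℕ) (f g : K⟦X⟧) : Prop := (PowerSeries.X : K⟦X⟧) ^ n ∣ f - g

namespace AgreeTo

variable {n : ℕ} {f g f₁ g₁ f₂ g₂ : K⟦X⟧}

theorem iff_coeff : AgreeTo n f g ↔ ∀ k < n, PowerSeries.coeff k f = PowerSeries.coeff k g := by
  simp only [AgreeTo, PowerSeries.X_pow_dvd_iff, map_sub, sub_eq_zero]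

theorem refl (n : ℕ) (f : K⟦X⟧) : AgreeTo n f f := by simp [AgreeTo]

theorem zero (f g : K⟦X⟧) : AgreeTo 0 f g := by simp [AgreeTo]

theorem mono {k : ℕ} (h : AgreeTo n f g) (hk : k ≤ n) : AgreeTo k f g :=
  (pow_dvd_pow _ hk).trans h

theorem add (h₁ : AgreeTo n f₁ g₁) (h₂ : AgreeTo n f₂ g₂) : AgreeTo n (f₁ + f₂) (g₁ + g₂) := by
  have := dvd_add h₁ h₂
  rwa [AgreeTo, add_sub_add_comm]

theorem mul (h₁ : AgreeTo n f₁ g₁) (h₂ : AgreeTo n f₂ g₂) : AgreeTo n (f₁ * f₂) (g₁ * g₂) := by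
  have := dvd_add (Dvd.dvd.mul_right h₁ f₂) (Dvd.dvd.mul_left h₂ g₁)
  rw [AgreeTo]
  convert this using 1
  ring

theorem mul_left (a : K⟦X⟧) (h : AgreeTo n f g) : AgreeTo n (a * f) (a * g) := (refl n a).mul h

theorem pow (h : AgreeTo n f g) (k : ℕ) : AgreeTo n (f ^ k) (g ^ k) :=
  h.trans (sub_dvd_pow_sub_pow f g k)

theorem inv (h : AgreeTo n f g) : AgreeTo n f⁻¹ g⁻¹ := by
  rcases Nat.eq_zero_or_pos n with rfl | hn
  · exact zero _ _
  have h0 : PowerSeries.constantCoeff f = PowerSeries.constantCoeff g := by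
    simpa using iff_coeff.1 h 0 hn
  by_cases hf : PowerSeries.constantCoeff f = 0
  · rw [PowerSeries.inv_eq_zero.2 hf, PowerSeries.inv_eq_zero.2 (h0 ▸ hf)]
    exact refl _ _
  · have e1 := PowerSeries.mul_inv_cancel f hf
    have e2 := PowerSeries.mul_inv_cancel g (h0 ▸ hf)
    have e3 : f⁻¹ - g⁻¹ = (f - g) * -(f⁻¹ * g⁻¹) := by
      linear_combination g⁻¹ * e1 - f⁻¹ * e2
    rw [AgreeTo, e3]
    exact Dvd.dvd.mul_right h _

theorem derivative (h : AgreeTo (n + 1) f g) :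
    AgreeTo n (PowerSeries.derivative K f) (PowerSeries.derivative K g) := by
  rw [iff_coeff] at h ⊢
  intro k hk
  rw [PowerSeries.coeff_derivative, PowerSeries.coeff_derivative, h (k + 1) (by omega)]

theorem of_derivative [CharZero K]
    (h : AgreeTo n (PowerSeries.derivative K f) (PowerSeries.derivative K g))
    (h0 : PowerSeries.constantCoeff f = PowerSeries.constantCoeff g) : AgreeTo (n + 1) f g := by
  rw [iff_coeff] at h ⊢
  intro k hk
  rcases k with _ | k
  · simpa using h0
  · have h1 := h k (by omega)
    rw [PowerSeries.coeff_derivative, PowerSeries.coeff_derivative] at h1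
    exact mul_right_cancel₀ (Nat.cast_add_one_ne_zero k) h1

end AgreeTo

/-- The formal initial value problem `f' = Φ f`, `f(0) = y`, for a causal right-hand side. -/
theorem exists_formal_solution [CharZero K] {ι : Type*} (Φ : (ι → K⟦X⟧) → ι → K⟦X⟧)
    (hΦ : ∀ n f g, (∀ i, AgreeTo n (f i) (g i)) → ∀ i, AgreeTo n (Φ f i) (Φ g i)) (y : ι → K) :
    ∃ f : ι → K⟦X⟧, ∀ i, PowerSeries.constantCoeff (f i) = y i ∧
      PowerSeries.derivative K (f i) = Φ f i := by
  -- The Picard operator: integrate `Φ f` formally, starting from `y`. Causality of `Φ` means that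
  -- integration gains one order of agreement.
  set T : (ι → K⟦X⟧) → ι → K⟦X⟧ := fun f i => PowerSeries.mk fun n =>
    if n = 0 then y i else PowerSeries.coeff (n - 1) (Φ f i) / n with hT
  have hT0 : ∀ f i, PowerSeries.constantCoeff (T f i) = y i := fun f i => by
    rw [← PowerSeries.coeff_zero_eq_constantCoeff_apply]
    simp [hT]
  have hTd : ∀ f i, PowerSeries.derivative K (T f i) = Φ f i := by
    intro f i
    ext n
    rw [PowerSeries.coeff_derivative]
    simp only [hT, PowerSeries.coeff_mk, Nat.succ_ne_zero, if_false, Nat.add_sub_cancel]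
    have : (n : K) + 1 ≠ 0 := Nat.cast_add_one_ne_zero n
    push_cast
    field_simp
  have hstep : ∀ n f g, (∀ i, AgreeTo n (f i) (g i)) → ∀ i, AgreeTo (n + 1) (T f i) (T g i) := by
    intro n f g h i
    refine AgreeTo.of_derivative ?_ ?_
    · rw [hTd, hTd]
      exact hΦ n f g h i
    · rw [hT0, hT0]
  have hiter : ∀ n i, AgreeTo n (T^[n] 0 i) (T^[n + 1] 0 i) := by
    intro n
    induction n with
    | zero => exact fun i => AgreeTo.zero _ _
    | succ n ih =>
      rw [Function.iterate_succ_apply', Function.iterate_succ_apply' T (n + 1)]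
      exact hstep n _ _ ih
  -- The coefficient of order `n` is stable from iterate `n + 1` on, so a diagonal choice gives the
  -- limit.
  set f : ι → K⟦X⟧ := fun i => PowerSeries.mk fun n => PowerSeries.coeff n (T^[n + 1] 0 i) with hf
  have hlim : ∀ n k, k < n → ∀ i, PowerSeries.coeff k (f i) = PowerSeries.coeff k (T^[n] 0 i) := by
    intro n
    induction n with
    | zero => intro k hk; omega
    | succ n ih =>
      intro k hk i
      rcases Nat.lt_succ_iff_lt_or_eq.1 hk with h | rfl
      · rw [ih k h i]
        exact AgreeTo.iff_coeff.1 (hiter n i) k h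
      · simp [hf]
  have hfix : ∀ i, T f i = f i := by
    intro i
    ext n
    have h1 : AgreeTo (n + 1) (T f i) (T^[n + 1] 0 i) := by
      rw [Function.iterate_succ_apply']
      exact hstep n _ _ (fun i => AgreeTo.iff_coeff.2 fun k hk => hlim n k hk i) i
    rw [AgreeTo.iff_coeff.1 h1 n (Nat.lt_succ_self n)]
    exact (hlim (n + 1) n (Nat.lt_succ_self n) i).symm
  refine ⟨f, fun i => ⟨?_, ?_⟩⟩
  · rw [← hfix i]; exact hT0 f i
  · rw [← hfix i, hTd]

end FormalODE

/-! ### Convergence of formal solutions of polynomial systems -/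

section Convergence

variable {𝕜 : Type*} [RCLike 𝕜]

/-- The norm `∑_{i ≤ n} ‖f_i‖ r^i` of the truncation of a power series. -/
def truncNorm (r : ℝ) (n : ℕ) (f : 𝕜⟦X⟧) : ℝ :=
  ∑ i ∈ Finset.range (n + 1), ‖PowerSeries.coeff i f‖ * r ^ i

theorem truncNorm_add_le {r : ℝ} (hr : 0 ≤ r) (n : ℕ) (f g : 𝕜⟦X⟧) :
    truncNorm r n (f + g) ≤ truncNorm r n f + truncNorm r n g := by
  rw [truncNorm, truncNorm, truncNorm, ← Finset.sum_add_distrib]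
  refine Finset.sum_le_sum fun i _ => ?_
  rw [← add_mul, map_add]
  exact mul_le_mul_of_nonneg_right (norm_add_le _ _) (pow_nonneg hr i)

theorem truncNorm_mul_le {r : ℝ} (hr : 0 ≤ r) (n : ℕ) (f g : 𝕜⟦X⟧) :
    truncNorm r n (f * g) ≤ truncNorm r n f * truncNorm r n g := by
  set φ : ℕ × ℕ → ℝ := fun p => (‖PowerSeries.coeff p.1 f‖ * r ^ p.1)
    * (‖PowerSeries.coeff p.2 g‖ * r ^ p.2) with hφ
  have hφ0 : ∀ p, 0 ≤ φ p := fun p => by positivity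
  have h1 : truncNorm r n (f * g)
      ≤ ∑ k ∈ Finset.range (n + 1), ∑ p ∈ Finset.HasAntidiagonal.antidiagonal k, φ p := by
    refine Finset.sum_le_sum fun k _ => ?_
    rw [PowerSeries.coeff_mul]
    refine (mul_le_mul_of_nonneg_right (norm_sum_le _ _) (pow_nonneg hr k)).trans ?_
    rw [Finset.sum_mul]
    refine Finset.sum_le_sum fun p hp => ?_
    rw [← Finset.HasAntidiagonal.mem_antidiagonal.1 hp, norm_mul, pow_add, hφ]
    exact le_of_eq (by ring)
  have h2 : ∑ k ∈ Finset.range (n + 1), ∑ p ∈ Finset.HasAntidiagonal.antidiagonal k, φ p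
      = ∑ p ∈ (Finset.range (n + 1) ×ˢ Finset.range (n + 1)).filter
          (fun p => p.1 + p.2 < n + 1), φ p := by
    rw [← Finset.sum_fiberwise_of_maps_to (t := Finset.range (n + 1)) (g := fun p : ℕ × ℕ => p.1 + p.2)]
    · refine Finset.sum_congr rfl fun k hk => Finset.sum_congr ?_ fun _ _ => rfl
      have := Finset.mem_range.1 hk
      ext p
      simp only [Finset.HasAntidiagonal.mem_antidiagonal, Finset.mem_filter, Finset.mem_product, Finset.mem_range]
      omega
    · intro p hp
      exact Finset.mem_range.2 (Finset.mem_filter.1 hp).2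
  refine h1.trans (h2.le.trans ((Finset.sum_le_sum_of_subset_of_nonneg (Finset.filter_subset _ _)
    fun p _ _ => hφ0 p).trans (le_of_eq ?_)))
  rw [truncNorm, truncNorm, Finset.sum_mul_sum, Finset.sum_product]

theorem truncNorm_algebraMap (r : ℝ) (n : ℕ) (a : 𝕜) :
    truncNorm r n (algebraMap 𝕜 𝕜⟦X⟧ a) = ‖a‖ := by
  rw [truncNorm, Finset.sum_eq_single 0]
  · simp
  · intro b _ hb
    simp [PowerSeries.coeff_C, hb]
  · simp

theorem truncNorm_nonneg {r : ℝ} (hr : 0 ≤ r) (n : ℕ) (f : 𝕜⟦X⟧) : 0 ≤ truncNorm r n f :=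
  Finset.sum_nonneg fun _ _ => by positivity

/-- Integrating divides a coefficient by an integer at least `1` and raises its weight by one factor
`r`. That factor closes the induction in `exists_convergesAt`. -/
theorem truncNorm_succ_le {r : ℝ} (hr : 0 ≤ r) (n : ℕ) (f : 𝕜⟦X⟧) :
    truncNorm r (n + 1) f
      ≤ ‖PowerSeries.coeff 0 f‖ + r * truncNorm r n (PowerSeries.derivative 𝕜 f) := by
  rw [truncNorm, Finset.sum_range_succ', pow_zero, mul_one, add_comm, truncNorm, Finset.mul_sum]
  refine add_le_add le_rfl (Finset.sum_le_sum fun i _ => ?_)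
  have h1 : ‖PowerSeries.coeff (i + 1) f‖
      ≤ ‖PowerSeries.coeff i (PowerSeries.derivative 𝕜 f)‖ := by
    rw [PowerSeries.coeff_derivative, norm_mul]
    refine le_mul_of_one_le_right (norm_nonneg _) ?_
    have : ((i : 𝕜) + 1) = ((i + 1 : ℕ) : 𝕜) := by push_cast; rfl
    rw [this, RCLike.norm_natCast]
    exact_mod_cast Nat.le_add_left 1 i
  calc ‖PowerSeries.coeff (i + 1) f‖ * r ^ (i + 1)
      ≤ ‖PowerSeries.coeff i (PowerSeries.derivative 𝕜 f)‖ * r ^ (i + 1) :=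
        mul_le_mul_of_nonneg_right h1 (pow_nonneg hr _)
    _ = _ := by ring

/-- The truncated norm is submultiplicative, so a polynomial expression in the generators is bounded
by the same expression in their bounds. The bound does not depend on `r` or `n`, which allows `r` to
be chosen afterwards. -/
theorem exists_truncNorm_bound {S : Set 𝕜⟦X⟧} (M : ℝ) {g : 𝕜⟦X⟧} (hg : g ∈ Algebra.adjoin 𝕜 S) :
    ∃ G : ℝ, ∀ r : ℝ, 0 ≤ r → ∀ n, (∀ f ∈ S, truncNorm r n f ≤ M) → truncNorm r n g ≤ G := by
  induction hg using Algebra.adjoin_induction with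
  | mem f hf => exact ⟨M, fun r _ n h => h f hf⟩
  | algebraMap a => exact ⟨‖a‖, fun r _ n _ => (truncNorm_algebraMap r n a).le⟩
  | add f g _ _ hf hg =>
    obtain ⟨A, hA⟩ := hf
    obtain ⟨B, hB⟩ := hg
    exact ⟨A + B, fun r hr n h => (truncNorm_add_le hr n f g).trans
      (add_le_add (hA r hr n h) (hB r hr n h))⟩
  | mul f g _ _ hf hg =>
    obtain ⟨A, hA⟩ := hf
    obtain ⟨B, hB⟩ := hg
    refine ⟨A * B, fun r hr n h => (truncNorm_mul_le hr n f g).trans ?_⟩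
    exact mul_le_mul (hA r hr n h) (hB r hr n h) (truncNorm_nonneg hr n g)
      ((truncNorm_nonneg hr n f).trans (hA r hr n h))

/-- The power series `f` converges absolutely at radius `r`. -/
def ConvergesAt (r : ℝ) (f : 𝕜⟦X⟧) : Prop := Summable fun n => ‖PowerSeries.coeff n f‖ * r ^ n

/-- Formal solutions of polynomial differential equations converge. -/
theorem exists_convergesAt (S : Finset 𝕜⟦X⟧)
    (hS : ∀ f ∈ S, PowerSeries.derivative 𝕜 f ∈ Algebra.adjoin 𝕜 (S : Set 𝕜⟦X⟧)) :
    ∃ r : ℝ, 0 < r ∧ ∀ f ∈ S, ConvergesAt r f := by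
  set M : ℝ := ∑ f ∈ S, ‖PowerSeries.coeff 0 f‖ + 1 with hM
  have hM' : ∀ f ∈ S, ‖PowerSeries.coeff 0 f‖ ≤ M - 1 := fun f hf => by
    rw [hM, add_sub_cancel_right]
    exact Finset.single_le_sum (f := fun f : 𝕜⟦X⟧ => ‖PowerSeries.coeff 0 f‖)
      (fun _ _ => norm_nonneg _) hf
  choose! G hG using fun f hf => exists_truncNorm_bound M (hS f hf)
  set B : ℝ := ∑ f ∈ S, |G f| with hB
  have hB0 : 0 ≤ B := Finset.sum_nonneg fun _ _ => abs_nonneg _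
  have hGB : ∀ f ∈ S, G f ≤ B := fun f hf => (le_abs_self _).trans
    (Finset.single_le_sum (f := fun f => |G f|) (fun _ _ => abs_nonneg _) hf)
  -- With this radius `r B ≤ 1`, exactly the slack by which `M` exceeds the initial values.
  set r : ℝ := (B + 1)⁻¹ with hr
  have hr0 : 0 < r := by positivity
  have hrB : r * B ≤ 1 := by
    rw [hr, inv_mul_le_iff₀ (by positivity)]
    linarith
  have hbound : ∀ n, ∀ f ∈ S, truncNorm r n f ≤ M := by
    intro n
    induction n with
    | zero =>
      intro f hf
      have := hM' f hf
      simp only [truncNorm, zero_add, Finset.range_one, Finset.sum_singleton, pow_zero, mul_one]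
      linarith
    | succ n ih =>
      intro f hf
      have h1 := truncNorm_succ_le hr0.le n f
      have h2 := hG f hf r hr0.le n ih
      have h3 : r * truncNorm r n (PowerSeries.derivative 𝕜 f) ≤ r * B :=
        mul_le_mul_of_nonneg_left (h2.trans (hGB f hf)) hr0.le
      have := hM' f hf
      linarith
  refine ⟨r, hr0, fun f hf => ?_⟩
  refine summable_of_sum_range_le (c := M) (fun n => by positivity) fun n => ?_
  refine le_trans ?_ (hbound n f hf)
  exact Finset.sum_le_sum_of_subset_of_nonneg (Finset.range_mono (Nat.le_succ n))
    fun _ _ _ => by positivity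

/-- The sum of the power series `f` at `x`. -/
def seriesEval (f : 𝕜⟦X⟧) (x : 𝕜) : 𝕜 := ∑' n, PowerSeries.coeff n f * x ^ n

namespace ConvergesAt

variable {r : ℝ} {f g : 𝕜⟦X⟧} {x : 𝕜}

theorem summable_norm (hf : ConvergesAt r f) (hx : ‖x‖ ≤ r) :
    Summable fun n => ‖PowerSeries.coeff n f * x ^ n‖ := by
  refine Summable.of_nonneg_of_le (fun _ => norm_nonneg _) (fun n => ?_) hf
  rw [norm_mul, norm_pow]
  exact mul_le_mul_of_nonneg_left (pow_le_pow_left₀ (norm_nonneg _) hx n) (norm_nonneg _)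

theorem add (hr : 0 ≤ r) (hf : ConvergesAt r f) (hg : ConvergesAt r g) :
    ConvergesAt r (f + g) := by
  refine Summable.of_nonneg_of_le (fun n => by positivity) (fun n => ?_) (Summable.add hf hg)
  rw [← add_mul, map_add]
  exact mul_le_mul_of_nonneg_right (norm_add_le _ _) (pow_nonneg hr n)

theorem mul (hr : 0 ≤ r) (hf : ConvergesAt r f) (hg : ConvergesAt r g) :
    ConvergesAt r (f * g) := by
  refine summable_of_sum_range_le (c := (∑' n, ‖PowerSeries.coeff n f‖ * r ^ n)
    * ∑' n, ‖PowerSeries.coeff n g‖ * r ^ n) (fun n => by positivity) fun n => ?_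
  refine (Finset.sum_le_sum_of_subset_of_nonneg (Finset.range_mono (Nat.le_succ n))
    fun _ _ _ => by positivity).trans ((truncNorm_mul_le hr n f g).trans ?_)
  exact mul_le_mul (Summable.sum_le_tsum _ (fun _ _ => by positivity) hf)
    (Summable.sum_le_tsum _ (fun _ _ => by positivity) hg) (truncNorm_nonneg hr n g)
    (tsum_nonneg fun _ => by positivity)

theorem of_C (r : ℝ) (a : 𝕜) : ConvergesAt r (PowerSeries.C a : 𝕜⟦X⟧) := by
  refine summable_of_ne_finset_zero (s := {0}) fun n hn => ?_
  have : n ≠ 0 := by simpa using hn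
  simp [PowerSeries.coeff_C, this]

theorem eval_add (hf : ConvergesAt r f) (hg : ConvergesAt r g) (hx : ‖x‖ ≤ r) :
    seriesEval (f + g) x = seriesEval f x + seriesEval g x := by
  rw [seriesEval, seriesEval, seriesEval,
    ← (hf.summable_norm hx).of_norm.tsum_add (hg.summable_norm hx).of_norm]
  simp [add_mul]

theorem eval_mul (hf : ConvergesAt r f) (hg : ConvergesAt r g) (hx : ‖x‖ ≤ r) :
    seriesEval (f * g) x = seriesEval f x * seriesEval g x := by
  rw [seriesEval, seriesEval, seriesEval,
    tsum_mul_tsum_eq_tsum_sum_antidiagonal_of_summable_norm (hf.summable_norm hx)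
      (hg.summable_norm hx)]
  refine tsum_congr fun n => ?_
  rw [PowerSeries.coeff_mul, Finset.sum_mul]
  refine Finset.sum_congr rfl fun p hp => ?_
  rw [← Finset.HasAntidiagonal.mem_antidiagonal.1 hp, pow_add]
  ring

theorem _root_.BKM.seriesEval_C (a x : 𝕜) : seriesEval (PowerSeries.C a : 𝕜⟦X⟧) x = a := by
  rw [seriesEval, tsum_eq_single 0]
  · simp
  · intro n hn
    simp [PowerSeries.coeff_C, hn]

theorem _root_.BKM.seriesEval_zero_right (f : 𝕜⟦X⟧) :
    seriesEval f 0 = PowerSeries.constantCoeff f := by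
  rw [seriesEval, tsum_eq_single 0]
  · simp
  · intro n hn
    simp [hn]

theorem mono {s : ℝ} (hs : 0 ≤ s) (hsr : s ≤ r) (hf : ConvergesAt r f) : ConvergesAt s f :=
  Summable.of_nonneg_of_le (fun n => by positivity) (fun n =>
    mul_le_mul_of_nonneg_left (pow_le_pow_left₀ hs hsr n) (norm_nonneg _)) hf

theorem derivative {s : ℝ} (hs : 0 ≤ s) (hsr : s < r) (hf : ConvergesAt r f) :
    ConvergesAt s (PowerSeries.derivative 𝕜 f) := by
  have hr : 0 < r := hs.trans_lt hsr
  have hq : s / r < 1 := (div_lt_one hr).2 hsr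
  obtain ⟨B, hB⟩ := (tendsto_self_mul_const_pow_of_lt_one (by positivity) hq).bddAbove_range
  have hB' : ∀ n : ℕ, (n : ℝ) * (s / r) ^ n ≤ B := fun n => hB ⟨n, rfl⟩
  have h1 : ∀ n : ℕ, ((n : ℝ) + 1) * (s / r) ^ n ≤ B + 1 := by
    intro n
    have h2 : (s / r) ^ n ≤ 1 := pow_le_one₀ (by positivity) hq.le
    nlinarith [hB' n]
  have h2 : Summable fun n => (B + 1) / r * (‖PowerSeries.coeff (n + 1) f‖ * r ^ (n + 1)) :=
    ((summable_nat_add_iff 1).2 hf).mul_left _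
  refine Summable.of_nonneg_of_le (fun n => by positivity) (fun n => ?_) h2
  have h3 : ‖((n : 𝕜) + 1)‖ = (n : ℝ) + 1 := by
    have : ((n : 𝕜) + 1) = ((n + 1 : ℕ) : 𝕜) := by push_cast; rfl
    rw [this, RCLike.norm_natCast]
    push_cast
    rfl
  rw [PowerSeries.coeff_derivative, norm_mul, h3]
  have h4 : s ^ n = (s / r) ^ n * r ^ n := by
    rw [div_pow, div_mul_cancel₀ _ (pow_ne_zero n hr.ne')]
  calc ‖PowerSeries.coeff (n + 1) f‖ * ((n : ℝ) + 1) * s ^ n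
      = (((n : ℝ) + 1) * (s / r) ^ n) * (‖PowerSeries.coeff (n + 1) f‖ * r ^ n) := by
        rw [h4]; ring
    _ ≤ (B + 1) * (‖PowerSeries.coeff (n + 1) f‖ * r ^ n) :=
        mul_le_mul_of_nonneg_right (h1 n) (by positivity)
    _ = (B + 1) / r * (‖PowerSeries.coeff (n + 1) f‖ * r ^ (n + 1)) := by
        rw [pow_succ]; field_simp

theorem hasDerivAt (hf : ConvergesAt r f) (hx : ‖x‖ < r) :
    HasDerivAt (seriesEval f) (seriesEval (PowerSeries.derivative 𝕜 f) x) x := by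
  obtain ⟨s, hxs, hsr⟩ := exists_between hx
  have hs : 0 < s := (norm_nonneg x).trans_lt hxs
  have hd := hf.derivative hs.le hsr
  have hpre : IsPreconnected (Metric.ball (0 : 𝕜) s) := by
    let _ : NormedSpace ℝ 𝕜 := NormedSpace.restrictScalars ℝ 𝕜 𝕜
    exact (convex_ball (0 : 𝕜) s).isPreconnected
  set u : ℕ → ℝ := fun n => ‖PowerSeries.coeff n f * n‖ * s ^ (n - 1) with hu
  have husum : Summable u := by
    refine (summable_nat_add_iff 1).1 (hd.congr fun n => ?_)
    rw [hu, PowerSeries.coeff_derivative]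
    simp only [Nat.cast_add, Nat.cast_one, Nat.add_sub_cancel]
  have h1 := hasDerivAt_tsum_of_isPreconnected (𝕜 := 𝕜) (F := 𝕜) (u := u)
    (g := fun n y => PowerSeries.coeff n f * y ^ n)
    (g' := fun n y => PowerSeries.coeff n f * (n * y ^ (n - 1))) (y₀ := 0) (y := x) husum
    Metric.isOpen_ball hpre (fun n y _ => (hasDerivAt_pow n y).const_mul _) (fun n y hy => by
      rw [← mul_assoc, norm_mul, norm_pow]
      exact mul_le_mul_of_nonneg_left (pow_le_pow_left₀ (norm_nonneg _)
        (mem_ball_zero_iff.1 hy).le _) (norm_nonneg _)) (Metric.mem_ball_self hs)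
    ((hf.summable_norm (by simpa using (hs.trans hsr).le)).of_norm) (mem_ball_zero_iff.2 hxs)
  refine h1.congr_deriv ?_
  have hsum : Summable fun n : ℕ => PowerSeries.coeff n f * (n * x ^ (n - 1)) := by
    refine (summable_nat_add_iff 1).1 (((hd.summable_norm hxs.le).of_norm).congr fun n => ?_)
    simp [PowerSeries.coeff_derivative, mul_assoc]
  rw [hsum.tsum_eq_zero_add, seriesEval]
  simp [PowerSeries.coeff_derivative, mul_assoc]

theorem iteratedDeriv_eq (hf : ConvergesAt r f) (hr : 0 < r) (n : ℕ) :
    iteratedDeriv n (seriesEval f) 0 = n.factorial * PowerSeries.coeff n f := by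
  induction n generalizing f r with
  | zero => simp [seriesEval_zero_right]
  | succ n ih =>
    have h1 : deriv (seriesEval f) =ᶠ[𝓝 0] seriesEval (PowerSeries.derivative 𝕜 f) := by
      filter_upwards [Metric.ball_mem_nhds (0 : 𝕜) hr] with y hy
      exact (hf.hasDerivAt (mem_ball_zero_iff.1 hy)).deriv
    rw [iteratedDeriv_succ', h1.iteratedDeriv_eq, ih (hf.derivative (s := r / 2) (by positivity)
      (by linarith)) (by positivity), PowerSeries.coeff_derivative, Nat.factorial_succ]
    push_cast
    ring

end ConvergesAt

end Convergence

/-! ### Formal profiles with a prescribed jet -/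

section FormalProfile

variable {K : Type*} [Field K]

theorem derivative_C_mul_inv_sq (c : K) {f : K⟦X⟧} :
    PowerSeries.derivative K (PowerSeries.C c * f⁻¹ ^ 2)
      = -2 * PowerSeries.C c * f⁻¹ ^ 3 * PowerSeries.derivative K f := by
  rw [Derivation.leibniz, PowerSeries.derivative_pow, PowerSeries.derivative_C,
    PowerSeries.derivative_inv']
  simp only [smul_eq_mul, Nat.cast_ofNat]
  ring

variable [CharZero K]

theorem exists_formal_linear_solution (U G : K⟦X⟧) (hU : PowerSeries.constantCoeff U ≠ 0) (y : K) :
    ∃ f : K⟦X⟧, PowerSeries.constantCoeff f = y ∧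
      2 * U * PowerSeries.derivative K f + PowerSeries.derivative K U * f = G := by
  obtain ⟨f, hf⟩ := exists_formal_solution (ι := Unit)
    (fun f i => (2 * U)⁻¹ * (G + -PowerSeries.derivative K U * f i))
    (fun n f g h i => AgreeTo.mul_left _ ((AgreeTo.refl n G).add ((h i).mul_left _)))
    (fun _ => y)
  obtain ⟨h1, h2⟩ := hf ()
  refine ⟨f (), h1, ?_⟩
  have h3 : PowerSeries.constantCoeff (2 * U) ≠ 0 := by
    rw [map_mul, map_ofNat]
    exact mul_ne_zero two_ne_zero hU
  have h4 := PowerSeries.mul_inv_cancel (2 * U) h3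
  rw [h2]
  linear_combination (G - PowerSeries.derivative K U * f ()) * h4

/-- The formal recursion that determines the Taylor coefficients of `σ` at the root of `m` from
the potential `U`. -/
theorem exists_formal_recursion (a : K) (U : K⟦X⟧) (hU : PowerSeries.constantCoeff U ≠ 0) :
    ∃ s : ℕ → K⟦X⟧, PowerSeries.constantCoeff (s 0) = 1 ∧
      U = PowerSeries.C (PowerSeries.constantCoeff U) * (s 0)⁻¹ ^ 2 ∧
      ∀ j, 2 * U * PowerSeries.derivative K (s (j + 1)) + PowerSeries.derivative K U * s (j + 1)
        = PowerSeries.C a * PowerSeries.derivative K (PowerSeries.derivative K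
            (PowerSeries.derivative K (s j))) - 2 * PowerSeries.derivative K (s j) := by
  choose sol hsol0 hsol using fun G => exists_formal_linear_solution U G hU 1
  set s : ℕ → K⟦X⟧ := fun j => Nat.rec (sol 0) (fun _ f => sol (PowerSeries.C a *
    PowerSeries.derivative K (PowerSeries.derivative K (PowerSeries.derivative K f))
      - 2 * PowerSeries.derivative K f)) j with hs
  have h0 : PowerSeries.constantCoeff (s 0) = 1 := hsol0 0
  refine ⟨s, h0, ?_, fun j => hsol _⟩
  have h1 : 2 * U * PowerSeries.derivative K (s 0) + PowerSeries.derivative K U * s 0 = 0 := hsol 0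
  -- The derivative of `U s_0²` is `s_0 (2Us_0' + U's_0) = 0`.
  have h2 : U * s 0 ^ 2 = PowerSeries.C (PowerSeries.constantCoeff U) := by
    refine PowerSeries.derivative.ext ?_ ?_
    · rw [Derivation.leibniz, PowerSeries.derivative_pow, PowerSeries.derivative_C]
      simp only [smul_eq_mul, Nat.cast_ofNat]
      linear_combination s 0 * h1
    · simp [h0]
  have h3 := PowerSeries.mul_inv_cancel (s 0) (by rw [h0]; exact one_ne_zero)
  rw [← h2]
  linear_combination (-U * (s 0 * (s 0)⁻¹ + 1)) * h3

/-- The formal solution with prescribed second order initial data. -/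
theorem exists_formal_flow {a U₀ : K} (ha : a ≠ 0) (N : ℕ) (y₀ y₁ y₂ : ℕ → K) (h₀ : y₀ N = 1)
    (h₁ : y₁ N = 0) (h₂ : y₂ N = 0) :
    ∃ s : ℕ → K⟦X⟧, (∀ j, PowerSeries.constantCoeff (s j) = y₀ j) ∧
      (∀ j, PowerSeries.constantCoeff (PowerSeries.derivative K (s j)) = y₁ j) ∧
      (∀ j, PowerSeries.constantCoeff (PowerSeries.derivative K
        (PowerSeries.derivative K (s j))) = y₂ j) ∧ s N = 1 ∧
      ∀ j < N, PowerSeries.C a * PowerSeries.derivative K (PowerSeries.derivative K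
          (PowerSeries.derivative K (s j)))
        = PowerSeries.derivative K (PowerSeries.C U₀ * (s 0)⁻¹ ^ 2) * s (j + 1)
          + 2 * (PowerSeries.C U₀ * (s 0)⁻¹ ^ 2) * PowerSeries.derivative K (s (j + 1))
          + 2 * PowerSeries.derivative K (s j) := by
  -- The third-order equations as a first-order system in `s_j, s_j', s_j''`. The derivative of `U =
  -- U₀ s_0⁻²` is written out through `s_0'` so that the right-hand side is causal. For `j ≥ N` the
  -- third derivative is set to zero, which keeps `s_N = 1`.
  set Φ : (Fin 3 × ℕ → K⟦X⟧) → Fin 3 × ℕ → K⟦X⟧ := fun f i =>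
    ![f (1, i.2), f (2, i.2), if i.2 < N then PowerSeries.C a⁻¹ *
      ((-2 * PowerSeries.C U₀ * (f (0, 0))⁻¹ ^ 3 * f (1, 0)) * f (0, i.2 + 1)
        + 2 * (PowerSeries.C U₀ * (f (0, 0))⁻¹ ^ 2) * f (1, i.2 + 1) + 2 * f (1, i.2)) else 0] i.1
    with hΦ
  obtain ⟨f, hf⟩ := exists_formal_solution Φ (by
    rintro n f g h ⟨i, j⟩
    fin_cases i
    · exact h (1, j)
    · exact h (2, j)
    · simp only [hΦ, Fin.reduceFinMk, Matrix.cons_val]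
      split_ifs
      · refine AgreeTo.mul_left _ (((AgreeTo.mul ?_ (h _)).add (AgreeTo.mul ?_ (h _))).add
          (AgreeTo.mul_left _ (h _)))
        · exact AgreeTo.mul (AgreeTo.mul_left _ ((h _).inv.pow 3)) (h _)
        · exact AgreeTo.mul_left _ (AgreeTo.mul_left _ ((h _).inv.pow 2))
      · exact AgreeTo.refl _ _) fun i => ![y₀ i.2, y₁ i.2, y₂ i.2] i.1
  have d0 : ∀ j, PowerSeries.derivative K (f (0, j)) = f (1, j) := fun j => (hf (0, j)).2
  have d1 : ∀ j, PowerSeries.derivative K (f (1, j)) = f (2, j) := fun j => (hf (1, j)).2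
  have d2 : ∀ j, PowerSeries.derivative K (f (2, j)) = if j < N then PowerSeries.C a⁻¹ *
      ((-2 * PowerSeries.C U₀ * (f (0, 0))⁻¹ ^ 3 * f (1, 0)) * f (0, j + 1)
        + 2 * (PowerSeries.C U₀ * (f (0, 0))⁻¹ ^ 2) * f (1, j + 1) + 2 * f (1, j)) else 0 :=
    fun j => (hf (2, j)).2
  have c0 : ∀ j, PowerSeries.constantCoeff (f (0, j)) = y₀ j := fun j => (hf (0, j)).1
  have c1 : ∀ j, PowerSeries.constantCoeff (f (1, j)) = y₁ j := fun j => (hf (1, j)).1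
  have c2 : ∀ j, PowerSeries.constantCoeff (f (2, j)) = y₂ j := fun j => (hf (2, j)).1
  refine ⟨fun j => f (0, j), c0, fun j => by rw [d0, c1], fun j => by rw [d0, d1, c2], ?_, ?_⟩
  · have e2 : f (2, N) = 0 := by
      refine PowerSeries.derivative.ext ?_ ?_
      · rw [d2, if_neg (lt_irrefl N), map_zero]
      · rw [c2, h₂, map_zero]
    have e1 : f (1, N) = 0 := by
      refine PowerSeries.derivative.ext ?_ ?_
      · rw [d1, e2, map_zero]
      · rw [c1, h₁, map_zero]
    refine PowerSeries.derivative.ext ?_ ?_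
    · rw [d0, e1, PowerSeries.derivative_one]
    · rw [c0, h₀, map_one]
  · intro j hj
    have haa : (PowerSeries.C a : K⟦X⟧) * PowerSeries.C a⁻¹ = 1 := by
      rw [← map_mul, mul_inv_cancel₀ ha, map_one]
    simp only [derivative_C_mul_inv_sq, d0, d1]
    rw [d2, if_pos hj, ← mul_assoc, haa, one_mul]

/-- Initial data for which the potential `U` of the formal solution has a prescribed jet; the top
coefficient may be chosen freely. -/
theorem exists_formal_profile {a : K} (ha : a ≠ 0) (k : ℕ) (W : K⟦X⟧)
    (hW : PowerSeries.constantCoeff W ≠ 0) :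
    ∃ y₀ y₁ y₂ : ℕ → K, y₀ 0 = 1 ∧ ∀ η θ : K, ∃ s : ℕ → K⟦X⟧,
      (∀ j ≤ k, PowerSeries.constantCoeff (s j) = y₀ j ∧
        PowerSeries.constantCoeff (PowerSeries.derivative K (s j)) = y₁ j ∧
        PowerSeries.constantCoeff (PowerSeries.derivative K
          (PowerSeries.derivative K (s j))) = y₂ j) ∧
      PowerSeries.constantCoeff (s (k + 1)) = η ∧
      PowerSeries.constantCoeff (PowerSeries.derivative K (s (k + 1))) = 0 ∧
      PowerSeries.constantCoeff (PowerSeries.derivative K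
        (PowerSeries.derivative K (s (k + 1)))) = θ ∧
      s (k + 2) = 1 ∧
      AgreeTo (k + 1) (PowerSeries.C (PowerSeries.constantCoeff W) * (s 0)⁻¹ ^ 2) W ∧
      ∀ j < k + 2, PowerSeries.C a * PowerSeries.derivative K (PowerSeries.derivative K
          (PowerSeries.derivative K (s j)))
        = PowerSeries.derivative K
            (PowerSeries.C (PowerSeries.constantCoeff W) * (s 0)⁻¹ ^ 2) * s (j + 1)
          + 2 * (PowerSeries.C (PowerSeries.constantCoeff W) * (s 0)⁻¹ ^ 2)
            * PowerSeries.derivative K (s (j + 1))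
          + 2 * PowerSeries.derivative K (s j) := by
  obtain ⟨t, ht0, htW, ht⟩ := exists_formal_recursion a W hW
  refine ⟨fun j => PowerSeries.constantCoeff (t j),
    fun j => PowerSeries.constantCoeff (PowerSeries.derivative K (t j)),
    fun j => PowerSeries.constantCoeff (PowerSeries.derivative K (PowerSeries.derivative K (t j))),
    ht0, fun η θ => ?_⟩
  -- Levels up to `k` start like `t`, level `k + 1` carries the free data `(η, 0, θ)`, and level `k
  -- + 2` is the leading coefficient `1`.
  obtain ⟨s, hs0, hs1, hs2, hsN, hs⟩ := exists_formal_flow (U₀ := PowerSeries.constantCoeff W) ha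
    (k + 2)
    (fun j => if j = k + 2 then 1 else if j = k + 1 then η else PowerSeries.constantCoeff (t j))
    (fun j => if j = k + 2 then 0 else if j = k + 1 then 0 else
      PowerSeries.constantCoeff (PowerSeries.derivative K (t j)))
    (fun j => if j = k + 2 then 0 else if j = k + 1 then θ else
      PowerSeries.constantCoeff (PowerSeries.derivative K (PowerSeries.derivative K (t j))))
    (if_pos rfl) (if_pos rfl) (if_pos rfl)
  have hlow : ∀ j ≤ k, PowerSeries.constantCoeff (s j) = PowerSeries.constantCoeff (t j) ∧
        PowerSeries.constantCoeff (PowerSeries.derivative K (s j))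
          = PowerSeries.constantCoeff (PowerSeries.derivative K (t j)) ∧
        PowerSeries.constantCoeff (PowerSeries.derivative K (PowerSeries.derivative K (s j)))
          = PowerSeries.constantCoeff (PowerSeries.derivative K
            (PowerSeries.derivative K (t j))) := by
    intro j hj
    have e1 : j ≠ k + 2 := by omega
    have e2 : j ≠ k + 1 := by omega
    rw [hs0, hs1, hs2]
    simp only [e1, e2, if_false, and_self]
  -- Agreement of `s_0`, `s_j` and `s_{j+1}` to order `r + 1` makes the third derivatives at level
  -- `j` agree to order `r`, and three integrations give more than the required `r + 2`. Whenever
  -- initial data are compared, `j ≤ k`, so the free level never enters.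
  have hagree : ∀ r j, j + r ≤ k + 1 → AgreeTo r (s j) (t j) := by
    intro r
    induction r with
    | zero => exact fun j _ => AgreeTo.zero _ _
    | succ r ih =>
      intro j hj
      obtain ⟨l0, l1, l2⟩ := hlow j (by omega)
      rcases r with _ | r
      · exact AgreeTo.of_derivative (AgreeTo.zero _ _) l0
      · have a0 := ih 0 (by omega)
        have aj := ih j (by omega)
        have aj' := ih (j + 1) (by omega)
        have aU : AgreeTo (r + 1)
            (PowerSeries.C (PowerSeries.constantCoeff W) * (s 0)⁻¹ ^ 2) W := by
          conv_rhs => rw [htW]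
          exact AgreeTo.mul_left _ (a0.inv.pow 2)
        have h3 : AgreeTo r
            (PowerSeries.derivative K (PowerSeries.derivative K (PowerSeries.derivative K (s j))))
            (PowerSeries.derivative K (PowerSeries.derivative K
              (PowerSeries.derivative K (t j)))) := by
          have haa : (PowerSeries.C a⁻¹ : K⟦X⟧) * PowerSeries.C a = 1 := by
            rw [← map_mul, inv_mul_cancel₀ ha, map_one]
          have e1 : PowerSeries.derivative K (PowerSeries.derivative K
              (PowerSeries.derivative K (t j))) = PowerSeries.C a⁻¹ *
                (PowerSeries.derivative K W * t (j + 1)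
                  + 2 * W * PowerSeries.derivative K (t (j + 1))
                  + 2 * PowerSeries.derivative K (t j)) := by
            linear_combination PowerSeries.C a⁻¹ * (-ht j) - (PowerSeries.derivative K
              (PowerSeries.derivative K (PowerSeries.derivative K (t j)))) * haa
          have e2 : PowerSeries.derivative K (PowerSeries.derivative K
              (PowerSeries.derivative K (s j))) = PowerSeries.C a⁻¹ * (PowerSeries.C a *
                PowerSeries.derivative K (PowerSeries.derivative K
                  (PowerSeries.derivative K (s j)))) := by
            rw [← mul_assoc, haa, one_mul]
          rw [e1, e2, hs j (by omega)]
          refine AgreeTo.mul_left _ (((AgreeTo.mul aU.derivative (aj'.mono (Nat.le_succ r))).add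
            (AgreeTo.mul (AgreeTo.mul_left _ (aU.mono (Nat.le_succ r))) aj'.derivative)).add
            (AgreeTo.mul_left _ aj.derivative))
        exact (((h3.of_derivative l2).of_derivative l1).of_derivative l0).mono (by omega)
  refine ⟨s, hlow, ?_, ?_, ?_, hsN, ?_, hs⟩
  · rw [hs0]; simp
  · rw [hs1]; simp
  · rw [hs2]; simp
  · conv_rhs => rw [htW]
    exact AgreeTo.mul_left _ ((hagree (k + 1) 0 (by omega)).inv.pow 2)

end FormalProfile

/-! ### Polynomials expanded at the root of `m` -/

section ShiftedPolynomials

variable {F : Type*} [Field F] {N : ℕ}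

/-- The polynomial of degree less than `N` with Taylor coefficients `f` at `μ₀`. -/
def shiftPoly (μ₀ : F) (N : ℕ) (f : ℕ → F) : F[X] :=
  ∑ j ∈ Finset.range N, C (f j) * (X - C μ₀) ^ j

theorem degree_shiftPoly_lt (μ₀ : F) (N : ℕ) (f : ℕ → F) : (shiftPoly μ₀ N f).degree < N := by
  refine mem_degreeLT.1 (Submodule.sum_mem _ fun j hj => mem_degreeLT.2 ?_)
  rw [← smul_eq_C_mul]
  refine (degree_smul_le _ _).trans_lt ?_
  rw [degree_pow, degree_X_sub_C, nsmul_one]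
  exact_mod_cast Finset.mem_range.1 hj

theorem coeff_shiftPoly (μ₀ : F) (n : ℕ) (f : ℕ → F) : (shiftPoly μ₀ (n + 1) f).coeff n = f n := by
  have h1 := ((monic_X_sub_C μ₀).pow n).coeff_natDegree
  rw [natDegree_pow, natDegree_X_sub_C, mul_one] at h1
  have h2 := coeff_eq_zero_of_degree_lt (degree_shiftPoly_lt μ₀ n f)
  rw [shiftPoly] at h2 ⊢
  rw [Finset.sum_range_succ, coeff_add, h2, coeff_C_mul, h1, zero_add, mul_one]

theorem eval_shiftPoly (μ₀ : F) (N : ℕ) (f : ℕ → F) (l : F) :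
    (shiftPoly μ₀ N f).eval l = ∑ j ∈ Finset.range N, f j * (l - μ₀) ^ j := by
  simp [shiftPoly, eval_finsetSum]

theorem degree_shiftPoly_lt_pow (μ₀ : F) (N : ℕ) (f : ℕ → F) :
    (shiftPoly μ₀ N f).degree < ((X - C μ₀) ^ N).degree := by
  rw [degree_pow, degree_X_sub_C, nsmul_one]
  exact degree_shiftPoly_lt μ₀ N f

theorem monic_pow_add_shiftPoly (μ₀ : F) (N : ℕ) (f : ℕ → F) :
    ((X - C μ₀) ^ N + shiftPoly μ₀ N f).Monic :=
  ((monic_X_sub_C μ₀).pow N).add_of_left (degree_shiftPoly_lt_pow μ₀ N f)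

theorem natDegree_pow_add_shiftPoly (μ₀ : F) (N : ℕ) (f : ℕ → F) :
    ((X - C μ₀) ^ N + shiftPoly μ₀ N f).natDegree = N := by
  rw [natDegree_add_eq_left_of_degree_lt (degree_shiftPoly_lt_pow μ₀ N f), natDegree_pow,
    natDegree_X_sub_C, mul_one]

theorem coeff_pow_add_shiftPoly (μ₀ : F) (n : ℕ) (f : ℕ → F) :
    ((X - C μ₀) ^ (n + 1) + shiftPoly μ₀ (n + 1) f).coeff n = f n - (n + 1) * μ₀ := by
  have h1 := (monic_X_sub_C μ₀).nextCoeff_pow (n + 1)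
  rw [nextCoeff_of_natDegree_pos (by rw [natDegree_pow, natDegree_X_sub_C]; omega), natDegree_pow,
    natDegree_X_sub_C, mul_one, Nat.add_sub_cancel, nextCoeff_X_sub_C] at h1
  rw [coeff_add, h1, coeff_shiftPoly]
  simp
  ring

theorem polyHasDerivAt_shiftPoly {𝕜 : Type*} [NontriviallyNormedField 𝕜] (μ₀ : 𝕜) (N : ℕ)
    {f : 𝕜 → ℕ → 𝕜} {f' : ℕ → 𝕜} {x : 𝕜} (h : ∀ j < N, HasDerivAt (fun y => f y j) (f' j) x) :
    PolyHasDerivAt (fun y => shiftPoly μ₀ N (f y)) (shiftPoly μ₀ N f') x := by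
  intro n
  simp only [shiftPoly, finsetSum_coeff]
  refine HasDerivAt.fun_sum fun j hj => ?_
  have h1 := (PolyHasDerivAt.C (h j (Finset.mem_range.1 hj))).mul
    (PolyHasDerivAt.const ((X - C μ₀) ^ j) x) n
  simpa using h1

end ShiftedPolynomials

/-! ### Realizing a jet by a convergent profile -/

section Realization

variable {𝕜 : Type*} [RCLike 𝕜]

/-- A formal solution of the flow converges. -/
theorem exists_convergesAt_flow {a U₀ : 𝕜} (ha : a ≠ 0) {N : ℕ} (s : ℕ → 𝕜⟦X⟧) (hN : 0 < N)
    (hsN : s N = 1)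
    (hs : ∀ j < N, PowerSeries.C a * PowerSeries.derivative 𝕜 (PowerSeries.derivative 𝕜
          (PowerSeries.derivative 𝕜 (s j)))
        = PowerSeries.derivative 𝕜 (PowerSeries.C U₀ * (s 0)⁻¹ ^ 2) * s (j + 1)
          + 2 * (PowerSeries.C U₀ * (s 0)⁻¹ ^ 2) * PowerSeries.derivative 𝕜 (s (j + 1))
          + 2 * PowerSeries.derivative 𝕜 (s j)) :
    ∃ r : ℝ, 0 < r ∧ ConvergesAt r (s 0)⁻¹ ∧ ∀ j < N, ConvergesAt r (s j) := by
  classical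
  set S : Finset 𝕜⟦X⟧ := {(s 0)⁻¹} ∪ ((Finset.range N).image s
    ∪ ((Finset.range N).image (fun j => PowerSeries.derivative 𝕜 (s j))
      ∪ (Finset.range N).image
        (fun j => PowerSeries.derivative 𝕜 (PowerSeries.derivative 𝕜 (s j))))) with hS
  have mv : (s 0)⁻¹ ∈ S := by simp [hS]
  have m0 : ∀ j < N, s j ∈ S := fun j hj => by
    simp only [hS, Finset.mem_union, Finset.mem_image, Finset.mem_range]
    exact Or.inr (Or.inl ⟨j, hj, rfl⟩)
  have m1 : ∀ j < N, PowerSeries.derivative 𝕜 (s j) ∈ S := fun j hj => by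
    simp only [hS, Finset.mem_union, Finset.mem_image, Finset.mem_range]
    exact Or.inr (Or.inr (Or.inl ⟨j, hj, rfl⟩))
  have m2 : ∀ j < N, PowerSeries.derivative 𝕜 (PowerSeries.derivative 𝕜 (s j)) ∈ S :=
    fun j hj => by
      simp only [hS, Finset.mem_union, Finset.mem_image, Finset.mem_range]
      exact Or.inr (Or.inr (Or.inr ⟨j, hj, rfl⟩))
  set A := Algebra.adjoin 𝕜 (S : Set 𝕜⟦X⟧) with hA
  have hsub : ∀ f ∈ S, f ∈ A := fun f hf => Algebra.subset_adjoin hf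
  have hC : ∀ b : 𝕜, (PowerSeries.C b : 𝕜⟦X⟧) ∈ A := fun b => by
    have := A.algebraMap_mem b
    rwa [PowerSeries.algebraMap_apply, Algebra.algebraMap_self_apply] at this
  have h2 : (2 : 𝕜⟦X⟧) ∈ A := by
    have := hC 2
    rwa [map_ofNat] at this
  have n0 : ∀ j ≤ N, s j ∈ A := fun j hj => by
    rcases hj.lt_or_eq with h | rfl
    · exact hsub _ (m0 j h)
    · rw [hsN]; exact one_mem A
  have n1 : ∀ j ≤ N, PowerSeries.derivative 𝕜 (s j) ∈ A := fun j hj => by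
    rcases hj.lt_or_eq with h | rfl
    · exact hsub _ (m1 j h)
    · rw [hsN, PowerSeries.derivative_one]; exact zero_mem A
  have nv := hsub _ mv
  obtain ⟨r, hr, hconv⟩ := exists_convergesAt S (by
    intro f hf
    simp only [hS, Finset.mem_union, Finset.mem_singleton, Finset.mem_image,
      Finset.mem_range] at hf
    rcases hf with rfl | ⟨j, hj, rfl⟩ | ⟨j, hj, rfl⟩ | ⟨j, hj, rfl⟩
    · rw [PowerSeries.derivative_inv']
      exact mul_mem (neg_mem (pow_mem nv 2)) (n1 0 hN.le)
    · exact hsub _ (m1 j hj)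
    · exact hsub _ (m2 j hj)
    · have haa : (PowerSeries.C a⁻¹ : 𝕜⟦X⟧) * PowerSeries.C a = 1 := by
        rw [← map_mul, inv_mul_cancel₀ ha, map_one]
      have e := congrArg (fun q => PowerSeries.C a⁻¹ * q) (hs j hj)
      rw [← mul_assoc, haa, one_mul, derivative_C_mul_inv_sq] at e
      rw [e]
      have n2 : (-2 : 𝕜⟦X⟧) ∈ A := neg_mem h2
      exact mul_mem (hC _) (add_mem (add_mem
        (mul_mem (mul_mem (mul_mem (mul_mem n2 (hC _)) (pow_mem nv 3)) (n1 0 hN.le))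
          (n0 _ hj))
        (mul_mem (mul_mem h2 (mul_mem (hC _) (pow_mem nv 2))) (n1 _ hj)))
        (mul_mem h2 (n1 _ hj.le))))
  exact ⟨r, hr, hconv _ mv, fun j hj => hconv _ (m0 j hj)⟩

/-- Compare coefficients of powers of `ν = X - μ₀`, with `X + u = ν + U`. The left side is divisible
by `ν`, so the constant term is the condition `h0`; the coefficient of `ν^(j+1)` is the recursion.
-/
theorem mul_shiftPoly_eq {F : Type*} [Field F] {m₁ μ₀ D U : F} {N : ℕ} {f f₁ f₃ : ℕ → F}
    (hfN : f N = 1) (hf₁N : f₁ N = 0) (h0 : D * f 0 + 2 * U * f₁ 0 = 0)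
    (h : ∀ j < N, m₁ * f₃ j = D * f (j + 1) + 2 * U * f₁ (j + 1) + 2 * f₁ j) :
    C m₁ * (X - C μ₀) * shiftPoly μ₀ N f₃
      = C D * ((X - C μ₀) ^ N + shiftPoly μ₀ N f)
        + 2 * (X + C (U - μ₀)) * shiftPoly μ₀ N f₁ := by
  set ν : F[X] := X - C μ₀ with hν
  have e1 : ν ^ N + shiftPoly μ₀ N f = ∑ j ∈ Finset.range (N + 1), C (f j) * ν ^ j := by
    rw [Finset.sum_range_succ, hfN, C_1, one_mul, add_comm]
    rfl
  have e2 : shiftPoly μ₀ N f₁ = ∑ j ∈ Finset.range (N + 1), C (f₁ j) * ν ^ j := by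
    rw [Finset.sum_range_succ, hf₁N, C_0, zero_mul, add_zero]
    rfl
  have e3 : (X : F[X]) + C (U - μ₀) = ν + C U := by
    rw [hν, C_sub]; ring
  have e4 : C D * ∑ j ∈ Finset.range (N + 1), C (f j) * ν ^ j
      + 2 * C U * ∑ j ∈ Finset.range (N + 1), C (f₁ j) * ν ^ j
      = ∑ j ∈ Finset.range N, C (D * f (j + 1) + 2 * U * f₁ (j + 1)) * ν ^ (j + 1) := by
    rw [Finset.mul_sum, Finset.mul_sum, ← Finset.sum_add_distrib, Finset.sum_range_succ']
    have h1 : C D * (C (f 0) * ν ^ 0) + 2 * C U * (C (f₁ 0) * ν ^ 0) = 0 := by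
      have := congrArg C h0
      simp only [map_add, map_mul, map_ofNat, map_zero] at this
      linear_combination this
    rw [h1, add_zero]
    refine Finset.sum_congr rfl fun j _ => ?_
    simp only [map_add, map_mul, map_ofNat]
    ring
  calc C m₁ * ν * shiftPoly μ₀ N f₃
      = ∑ j ∈ Finset.range N, C (m₁ * f₃ j) * ν ^ (j + 1) := by
        rw [shiftPoly, Finset.mul_sum]
        refine Finset.sum_congr rfl fun j _ => ?_
        rw [C_mul]; ring
    _ = ∑ j ∈ Finset.range N, C (D * f (j + 1) + 2 * U * f₁ (j + 1)) * ν ^ (j + 1)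
          + 2 * ν * shiftPoly μ₀ N f₁ := by
        rw [shiftPoly, Finset.mul_sum, ← Finset.sum_add_distrib]
        refine Finset.sum_congr rfl fun j hj => ?_
        rw [h j (Finset.mem_range.1 hj)]
        simp only [map_add, map_mul, map_ofNat]
        ring
    _ = _ := by
        rw [e3, e1, ← e4, mul_add, add_mul, ← e2]
        ring

/-- The jet fixes all data except those of the level `k + 1`, and these serve the normalization and
the speed. `hspeed` is stated for arbitrary `β`, `γ` because only the leading coefficient of `c(l)`,
as a quadratic in the rescaled free parameter, is controlled by `jt 0`. -/
theorem isFiniteGapJet_of_speed {m₁ μ₀ : 𝕜} (hm : m₁ ≠ 0) (lam : OnePoint 𝕜) (k : ℕ)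
    (jt : Fin (k + 1) → 𝕜) (h0 : jt 0 + μ₀ ≠ 0)
    (hroot : lam = (μ₀ : OnePoint 𝕜) → ∃ b : 𝕜, b ≠ 0 ∧ b ^ 2 = jt 0 + μ₀)
    (hspeed : ∀ l : 𝕜, lam = (l : OnePoint 𝕜) → l ≠ μ₀ → ∀ β γ : 𝕜, ∃ y b : 𝕜, b ≠ 0 ∧
      b ^ 2 = (jt 0 + μ₀ - (l - μ₀)) * y ^ 2 + β * y + γ) :
    IsFiniteGapJet (C m₁ * (X - C μ₀)) lam k jt := by
  set W : 𝕜⟦X⟧ := PowerSeries.mk (fun i => if h : i < k + 1 then jt ⟨i, h⟩ / i.factorial else 0)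
    + PowerSeries.C μ₀ with hWdef
  have hW0 : PowerSeries.constantCoeff W = jt 0 + μ₀ := by
    rw [hWdef, map_add, PowerSeries.constantCoeff_C, ← PowerSeries.coeff_zero_eq_constantCoeff_apply]
    simp
  obtain ⟨y₀, y₁, y₂, hy₀, hex⟩ := exists_formal_profile hm k W (by rwa [hW0])
  rw [hW0] at hex
  set U₀ := jt 0 + μ₀ with hU₀
  set N := k + 2 with hN
  set S₀ : 𝕜 → 𝕜 := fun l => (l - μ₀) ^ N + ∑ j ∈ Finset.range (k + 1), y₀ j * (l - μ₀) ^ j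
  set T₀ : 𝕜 → 𝕜 := fun l => ∑ j ∈ Finset.range (k + 1), y₁ j * (l - μ₀) ^ j
  set R₀ : 𝕜 → 𝕜 := fun l => ∑ j ∈ Finset.range (k + 1), y₂ j * (l - μ₀) ^ j
  -- This solves `u + 2σ_{N-1} - m₁ρ_{N-1} = 0` at `x = 0`, where `u = U₀ - μ₀`, `σ_{N-1} = η - Nμ₀`
  -- and `ρ_{N-1} = θ`.
  set θ : 𝕜 → 𝕜 := fun η => (2 * η + U₀ - (2 * N + 1) * μ₀) / m₁ with hθ
  have hmθ : ∀ η, m₁ * θ η = 2 * η + U₀ - (2 * N + 1) * μ₀ := fun η => by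
    rw [hθ]; field_simp
  obtain ⟨η, hη⟩ : ∃ η : 𝕜, ∀ l : 𝕜, lam = (l : OnePoint 𝕜) → ∃ b : 𝕜, b ≠ 0 ∧ b ^ 2 =
      (l + (U₀ - μ₀)) * (S₀ l + η * (l - μ₀) ^ (k + 1)) ^ 2
        + m₁ * (l - μ₀) * (1 / 2 * T₀ l ^ 2 - (S₀ l + η * (l - μ₀) ^ (k + 1))
          * (R₀ l + θ η * (l - μ₀) ^ (k + 1))) := by
    by_cases hfin : ∃ l : 𝕜, lam = (l : OnePoint 𝕜)
    · obtain ⟨l, rfl⟩ := hfin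
      by_cases hl : l = μ₀
      -- At `l = μ₀` the polynomial `m` vanishes and `σ(μ₀) = s_0(0) = 1`, so `c(μ₀) = U₀` whatever
      -- `η` is.
      · obtain ⟨b, hb, hb'⟩ := hroot (by rw [hl])
        refine ⟨0, fun l' hl' => ?_⟩
        obtain rfl : l = l' := OnePoint.coe_injective hl'
        refine ⟨b, hb, ?_⟩
        have hS : S₀ l = 1 := by
          simp only [S₀, hl, sub_self, Finset.sum_range_succ']
          simp [hy₀, hN]
        rw [hb', hS, hl]
        ring
      -- In `y = ηL` the value `c(l)` is quadratic. Its leading coefficient is `l - μ₀ + U₀` from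
      -- `σ²`, minus `2(l - μ₀)` from `mσρ`, since `m₁θL = 2y + q`.
      · set L := (l - μ₀) ^ (k + 1) with hL
        have hL0 : L ≠ 0 := pow_ne_zero _ (sub_ne_zero.2 hl)
        set q := L * (U₀ - (2 * N + 1) * μ₀) with hq
        obtain ⟨y, b, hb, hb'⟩ := hspeed l rfl hl
          (2 * (l + (U₀ - μ₀)) * S₀ l - (l - μ₀) * (2 * S₀ l + q + m₁ * R₀ l))
          ((l + (U₀ - μ₀)) * S₀ l ^ 2 + (l - μ₀) * (m₁ * (1 / 2) * T₀ l ^ 2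
            - S₀ l * (m₁ * R₀ l + q)))
        refine ⟨y / L, fun l' hl' => ?_⟩
        obtain rfl : l = l' := OnePoint.coe_injective hl'
        refine ⟨b, hb, ?_⟩
        have e1 : y / L * L = y := div_mul_cancel₀ y hL0
        have e2 : m₁ * (θ (y / L) * L) = 2 * y + q := by
          rw [← mul_assoc, hmθ, hq]
          linear_combination 2 * e1
        rw [hb', e1]
        linear_combination (l - μ₀) * (S₀ l + y) * e2
    · exact ⟨0, fun l hl => absurd ⟨l, hl⟩ hfin⟩
  obtain ⟨s, hlow, hsη, hs1, hsθ, hsN, hagree, hs⟩ := hex η (θ η)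
  have hs00 : PowerSeries.constantCoeff (s 0) = 1 := (hlow 0 (Nat.zero_le k)).1.trans hy₀
  set v := (s 0)⁻¹ with hv
  have hvs : s 0 * v = 1 := PowerSeries.mul_inv_cancel (s 0) (by rw [hs00]; exact one_ne_zero)
  set V := PowerSeries.C U₀ * v ^ 2 with hV
  obtain ⟨r, hr, hvc, hsc⟩ := exists_convergesAt_flow hm s (by omega : 0 < k + 2) hsN hs
  have hVc : ConvergesAt r V := by
    rw [hV, pow_two]
    exact (ConvergesAt.of_C r U₀).mul hr.le (hvc.mul hr.le hvc)
  have hsc' : ∀ j ≤ N, ConvergesAt r (s j) := fun j hj => by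
    rcases hj.lt_or_eq with h | rfl
    · exact hsc j h
    · rw [hsN, ← map_one PowerSeries.C]; exact ConvergesAt.of_C r 1
  -- Each termwise differentiation costs some radius; three of them fit into `r/2`, `r/4`, `r/8`,
  -- and all series are then compared at radius `r/8`.
  have hr2 : 0 < r / 2 := by positivity
  have hr4 : 0 < r / 4 := by positivity
  have c1 : ∀ j ≤ N, ConvergesAt (r / 2) (PowerSeries.derivative 𝕜 (s j)) := fun j hj =>
    (hsc' j hj).derivative hr2.le (by linarith)
  have c2 : ∀ j ≤ N, ConvergesAt (r / 4)
      (PowerSeries.derivative 𝕜 (PowerSeries.derivative 𝕜 (s j))) := fun j hj =>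
    (c1 j hj).derivative hr4.le (by linarith)
  have hr8 : 0 < r / 8 := by positivity
  have c3 : ∀ j ≤ N, ConvergesAt (r / 8) (PowerSeries.derivative 𝕜
      (PowerSeries.derivative 𝕜 (PowerSeries.derivative 𝕜 (s j)))) := fun j hj =>
    (c2 j hj).derivative hr8.le (by linarith)
  have c0' : ∀ j ≤ N, ConvergesAt (r / 8) (s j) := fun j hj =>
    (hsc' j hj).mono hr8.le (by linarith)
  have c1' : ∀ j ≤ N, ConvergesAt (r / 8) (PowerSeries.derivative 𝕜 (s j)) := fun j hj =>
    (c1 j hj).mono hr8.le (by linarith)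
  have cV : ConvergesAt (r / 8) V := hVc.mono hr8.le (by linarith)
  have cV' : ConvergesAt (r / 8) (PowerSeries.derivative 𝕜 V) :=
    hVc.derivative hr8.le (by linarith)
  have cC : ∀ b : 𝕜, ConvergesAt (r / 8) (PowerSeries.C b : 𝕜⟦X⟧) := fun b =>
    ConvergesAt.of_C _ b
  have e2 : (2 : 𝕜⟦X⟧) = PowerSeries.C (2 : 𝕜) := (map_ofNat PowerSeries.C 2).symm
  have hball : ∀ᶠ x in 𝓝 (0 : 𝕜), ‖x‖ < r / 8 := by
    filter_upwards [Metric.ball_mem_nhds (0 : 𝕜) hr8] with x hx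
    exact mem_ball_zero_iff.1 hx
  set σ : 𝕜 → 𝕜[X] := fun x =>
    (X - C μ₀) ^ N + shiftPoly μ₀ N (fun j => seriesEval (s j) x) with hσ
  set τ : 𝕜 → 𝕜[X] := fun x =>
    shiftPoly μ₀ N (fun j => seriesEval (PowerSeries.derivative 𝕜 (s j)) x) with hτ
  set ρ : 𝕜 → 𝕜[X] := fun x => shiftPoly μ₀ N (fun j =>
    seriesEval (PowerSeries.derivative 𝕜 (PowerSeries.derivative 𝕜 (s j))) x) with hρ
  set ρ' : 𝕜 → 𝕜[X] := fun x => shiftPoly μ₀ N (fun j => seriesEval (PowerSeries.derivative 𝕜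
    (PowerSeries.derivative 𝕜 (PowerSeries.derivative 𝕜 (s j)))) x) with hρ'
  have hV0 : seriesEval V 0 = U₀ := by
    rw [seriesEval_zero_right, hV, map_mul, map_pow, hv, PowerSeries.constantCoeff_inv, hs00]
    simp
  have hformal : PowerSeries.derivative 𝕜 V * s 0 + PowerSeries.C 2 * V
      * PowerSeries.derivative 𝕜 (s 0) = 0 := by
    rw [← e2, hV, hv, derivative_C_mul_inv_sq, ← hv]
    linear_combination (-2 * PowerSeries.C U₀ * v ^ 2 * PowerSeries.derivative 𝕜 (s 0)) * hvs
  refine ⟨N, _, _, _, _, isFiniteGapSolution_of_profile (N := N) (σ := σ) (τ := τ) (ρ := ρ)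
    (ρ' := ρ') (u := fun x => seriesEval V x - μ₀)
    (u' := fun x => seriesEval (PowerSeries.derivative 𝕜 V) x) (by omega) hm lam
    (fun x => monic_pow_add_shiftPoly _ _ _) (fun x => natDegree_pow_add_shiftPoly _ _ _)
    (fun x => degree_shiftPoly_lt _ _ _) (fun x => degree_shiftPoly_lt _ _ _)
    ?_ ?_ ?_ ?_ ?_ ?_ ?_ ?_, ?_⟩
  · filter_upwards [hball] with x hx
    have h1 := (PolyHasDerivAt.const ((X - C μ₀) ^ N) x).add (polyHasDerivAt_shiftPoly μ₀ N
      (fun j hj => (c0' j hj.le).hasDerivAt hx))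
    rwa [zero_add] at h1
  · filter_upwards [hball] with x hx
    exact polyHasDerivAt_shiftPoly μ₀ N fun j hj => (c1' j hj.le).hasDerivAt hx
  · filter_upwards [hball] with x hx
    exact polyHasDerivAt_shiftPoly μ₀ N fun j hj => (c2 j hj.le).hasDerivAt (by linarith)
  · filter_upwards [hball] with x hx
    exact (cV.hasDerivAt hx).sub_const μ₀
  · have hcont : ContinuousAt (seriesEval (s 0)) 0 :=
      ((c0' 0 (Nat.zero_le _)).hasDerivAt (x := 0) (by simpa using hr8)).continuousAt
    have h1 : seriesEval (s 0) 0 ≠ 0 := by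
      rw [seriesEval_zero_right, hs00]; exact one_ne_zero
    filter_upwards [hcont.eventually_ne h1] with x hx
    rw [hσ]
    simp only [eval_add, eval_pow, eval_sub, eval_X, eval_C, sub_self, eval_shiftPoly]
    rw [hN, Finset.sum_range_succ']
    simpa using hx
  · filter_upwards [hball] with x hx
    refine mul_shiftPoly_eq ?_ ?_ ?_ ?_
    · rw [hsN, ← map_one PowerSeries.C, seriesEval_C]
    · rw [hsN, PowerSeries.derivative_one, ← map_zero PowerSeries.C, seriesEval_C]
    · have h1 := congrArg (fun f => seriesEval f x) hformal
      rw [ConvergesAt.eval_add (cV'.mul hr8.le (c0' 0 (Nat.zero_le _)))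
          (((cC 2).mul hr8.le cV).mul hr8.le (c1' 0 (Nat.zero_le _))) hx.le,
        ConvergesAt.eval_mul cV' (c0' 0 (Nat.zero_le _)) hx.le,
        ConvergesAt.eval_mul ((cC 2).mul hr8.le cV) (c1' 0 (Nat.zero_le _)) hx.le,
        ConvergesAt.eval_mul (cC 2) cV hx.le, seriesEval_C, ← map_zero PowerSeries.C,
        seriesEval_C] at h1
      exact h1
    · intro j hj
      have h1 := congrArg (fun f => seriesEval f x) (hs j hj)
      simp only [e2] at h1
      have d1 := cV'.mul hr8.le (c0' (j + 1) hj)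
      have d2 := ((cC 2).mul hr8.le cV).mul hr8.le (c1' (j + 1) hj)
      have d3 := (cC 2).mul hr8.le (c1' j hj.le)
      rw [ConvergesAt.eval_add (d1.add hr8.le d2) d3 hx.le, ConvergesAt.eval_add d1 d2 hx.le,
        ConvergesAt.eval_mul cV' (c0' (j + 1) hj) hx.le,
        ConvergesAt.eval_mul ((cC 2).mul hr8.le cV) (c1' (j + 1) hj) hx.le,
        ConvergesAt.eval_mul (cC 2) cV hx.le, ConvergesAt.eval_mul (cC 2) (c1' j hj.le) hx.le,
        ConvergesAt.eval_mul (cC m₁) (c3 j hj.le) hx.le, seriesEval_C, seriesEval_C] at h1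
      exact h1
  · have e3 : N - 1 = k + 1 := by omega
    rw [e3, hσ, hρ]
    simp only [hN]
    rw [coeff_pow_add_shiftPoly, coeff_shiftPoly, hV0, seriesEval_zero_right,
      seriesEval_zero_right, hsη, hsθ, hmθ, hN]
    push_cast
    ring
  · intro l hl
    obtain ⟨b, hb, hb'⟩ := hη l hl
    refine ⟨b, hb, hb'.trans ?_⟩
    have hsum : ∀ (f : ℕ → 𝕜) (g : ℕ → 𝕜), (∀ j ≤ k, f j = g j) →
        ∑ j ∈ Finset.range (k + 2), f j * (l - μ₀) ^ j
          = ∑ j ∈ Finset.range (k + 1), g j * (l - μ₀) ^ j + f (k + 1) * (l - μ₀) ^ (k + 1) := by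
      intro f g hfg
      rw [Finset.sum_range_succ]
      congr 1
      refine Finset.sum_congr rfl fun j hj => ?_
      rw [hfg j (by have := Finset.mem_range.1 hj; omega)]
    have eσ : (σ 0).eval l = S₀ l + η * (l - μ₀) ^ (k + 1) := by
      simp only [hσ, eval_add, eval_pow, eval_sub, eval_X, eval_C, eval_shiftPoly,
        seriesEval_zero_right]
      rw [hsum _ y₀ fun j hj => (hlow j hj).1, hsη, add_assoc]
    have eτ : (τ 0).eval l = T₀ l := by
      simp only [hτ, eval_shiftPoly, seriesEval_zero_right]
      rw [hsum _ y₁ fun j hj => (hlow j hj).2.1, hs1, zero_mul, add_zero]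
    have eρ : (ρ 0).eval l = R₀ l + θ η * (l - μ₀) ^ (k + 1) := by
      simp only [hρ, eval_shiftPoly, seriesEval_zero_right]
      rw [hsum _ y₂ fun j hj => (hlow j hj).2.2, hsθ]
    rw [energyPoly]
    simp only [eval_add, eval_mul, eval_pow, eval_sub, eval_X, eval_C, eσ, eτ, eρ, hV0]
  · funext i
    have h1 : (fun x => seriesEval V x - μ₀) =ᶠ[𝓝 0] seriesEval (V + PowerSeries.C (-μ₀)) := by
      filter_upwards [hball] with x hx
      rw [ConvergesAt.eval_add cV (cC _) hx.le, seriesEval_C, sub_eq_add_neg]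
    have h2 := AgreeTo.iff_coeff.1 hagree i.val i.isLt
    have h3 : (PowerSeries.C μ₀ + PowerSeries.C (-μ₀) : 𝕜⟦X⟧) = 0 := by
      rw [← map_add, add_neg_cancel, map_zero]
    rw [jet, h1.iteratedDeriv_eq, (cV.add hr8.le (cC _)).iteratedDeriv_eq hr8, map_add, h2,
      ← map_add, hWdef, add_assoc, h3, add_zero, PowerSeries.coeff_mk, dif_pos i.isLt]
    exact mul_div_cancel₀ _ (Nat.cast_ne_zero.2 (Nat.factorial_ne_zero _))

end Realization

/-! ### Choosing the free parameter and the set of jets -/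

theorem exists_eq_C_mul_X_sub_C {F : Type*} [Field F] {m : F[X]} (h : m.natDegree = 1) :
    ∃ m₁ μ₀ : F, m₁ ≠ 0 ∧ m = C m₁ * (X - C μ₀) := by
  obtain ⟨a, ha, b, hb⟩ := natDegree_eq_one.1 h
  refine ⟨a, -(b / a), ha, ?_⟩
  rw [← hb, mul_sub, ← C_mul, mul_neg, mul_div_cancel₀ b ha, C_neg, sub_neg_eq_add]

theorem exists_quadratic_pos {a : ℝ} (ha : 0 < a) (β γ : ℝ) :
    ∃ y : ℝ, 0 < a * y ^ 2 + β * y + γ := by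
  set y := (|β| + |γ|) / a + 1 with hy
  have h1 : a * y = |β| + |γ| + a := by rw [hy]; field_simp
  have h2 : 1 ≤ y := by
    have : 0 ≤ (|β| + |γ|) / a := by positivity
    linarith
  have h3 := neg_abs_le β
  have h4 := neg_abs_le γ
  refine ⟨y, ?_⟩
  have h5 : a * y ^ 2 + β * y + γ = y * (a * y + β) + γ := by ring
  have h6 : |γ| + a ≤ y * (a * y + β) := by
    have : |γ| + a ≤ a * y + β := by linarith
    have h7 : 0 ≤ |γ| + a := by positivity
    nlinarith
  linarith

/-- The second difference of the values at `-1`, `0`, `1` is `2a`, so not all three vanish. -/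
theorem exists_quadratic_ne_zero {a : ℂ} (ha : a ≠ 0) (β γ : ℂ) :
    ∃ y : ℂ, a * y ^ 2 + β * y + γ ≠ 0 := by
  by_contra! h
  have h0 := h 0
  have h1 := h 1
  have h2 := h (-1)
  apply ha
  linear_combination (1 / 2) * h1 + (1 / 2) * h2 - h0

theorem isZariskiOpen_setOf_eval_ne_zero {ι : Type*} (f : MvPolynomial ι ℂ) :
    IsZariskiOpen {x : ι → ℂ | MvPolynomial.eval x f ≠ 0} := by
  refine ⟨Ideal.span {f}, ?_⟩
  ext x
  simp only [Set.mem_ofPred_eq, Set.mem_compl_iff, MvPolynomial.zeroLocus_span,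
    Set.mem_singleton_iff, forall_eq]
  rfl

end BKM
end

theorem theorem2 :
    (∀ (m : Polynomial ℝ) (lam : OnePoint ℝ) (k : ℕ), m.natDegree = 1 →
      ∃ U : Set (Fin (k + 1) → ℝ), IsOpen U ∧ U.Nonempty ∧
        ∀ j ∈ U, BKM.IsFiniteGapJet m lam k j) ∧
    (∀ (m : Polynomial ℂ) (lam : OnePoint ℂ) (k : ℕ), m.natDegree = 1 →
      ∃ U : Set (Fin (k + 1) → ℂ), BKM.IsZariskiOpen U ∧ Dense U ∧
        ∀ j ∈ U, BKM.IsFiniteGapJet m lam k j) := by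
  constructor
  · intro m lam k hm
    obtain ⟨m₁, μ₀, hm₁, rfl⟩ := BKM.exists_eq_C_mul_X_sub_C hm
    -- For `lam = ∞` there is no speed condition and `B = 0` is a harmless default that only shrinks
    -- `U`.
    obtain ⟨B, hB⟩ : ∃ B : ℝ, ∀ l : ℝ, lam = (l : OnePoint ℝ) → l - μ₀ ≤ B := by
      induction lam using OnePoint.rec with
      | infty => exact ⟨0, fun l hl => absurd hl.symm (OnePoint.coe_ne_infty l)⟩
      | coe x => exact ⟨x - μ₀, fun l hl => by rw [OnePoint.coe_injective hl]⟩
    -- The two inequalities make `U₀` and `U₀ - (l - μ₀)` positive. The first gives the square root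
    -- at `l = μ₀`; the second gives the quadratic a positive value.
    refine ⟨{j | 0 < j 0 + μ₀ ∧ B < j 0 + μ₀}, ?_, ⟨fun _ => |B| + 1 - μ₀, ?_, ?_⟩, ?_⟩
    · have hc : Continuous fun j : Fin (k + 1) → ℝ => j 0 + μ₀ := by fun_prop
      exact (isOpen_lt continuous_const hc).inter (isOpen_lt continuous_const hc)
    · have := abs_nonneg B
      linarith
    · have := le_abs_self B
      linarith
    · rintro j ⟨h0, h1⟩
      refine BKM.isFiniteGapJet_of_speed hm₁ lam k j h0.ne' (fun _ => ?_) fun l hl _ β γ => ?_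
      · exact ⟨√(j 0 + μ₀), (Real.sqrt_pos.2 h0).ne', Real.sq_sqrt h0.le⟩
      · have := hB l hl
        obtain ⟨y, hy⟩ := BKM.exists_quadratic_pos
          (by linarith : 0 < j 0 + μ₀ - (l - μ₀)) β γ
        exact ⟨y, _, (Real.sqrt_pos.2 hy).ne', Real.sq_sqrt hy.le⟩
  · intro m lam k hm
    obtain ⟨m₁, μ₀, hm₁, rfl⟩ := BKM.exists_eq_C_mul_X_sub_C hm
    obtain ⟨B, hB⟩ : ∃ B : ℂ, ∀ l : ℂ, lam = (l : OnePoint ℂ) → l = B := by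
      induction lam using OnePoint.rec with
      | infty => exact ⟨0, fun l hl => absurd hl.symm (OnePoint.coe_ne_infty l)⟩
      | coe x => exact ⟨x, fun l hl => (OnePoint.coe_injective hl).symm⟩
    -- The set is the preimage, under the open map `j ↦ j 0`, of the complement of at most two
    -- points; this gives density.
    have hset : {j : Fin (k + 1) → ℂ | MvPolynomial.eval j
        ((MvPolynomial.X 0 + MvPolynomial.C μ₀) *
          (MvPolynomial.X 0 + MvPolynomial.C μ₀ - MvPolynomial.C (B - μ₀))) ≠ 0}
        = (fun j : Fin (k + 1) → ℂ => j 0) ⁻¹' {-μ₀, B - μ₀ - μ₀}ᶜ := by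
      ext j
      simp [sub_eq_zero, eq_neg_iff_add_eq_zero, eq_sub_iff_add_eq]
    refine ⟨_, BKM.isZariskiOpen_setOf_eval_ne_zero ((MvPolynomial.X 0 + MvPolynomial.C μ₀) *
          (MvPolynomial.X 0 + MvPolynomial.C μ₀ - MvPolynomial.C (B - μ₀))), ?_, ?_⟩
    · rw [hset]
      rw [Set.compl_eq_univ_sdiff]
      exact (dense_univ.sdiff_finite (Set.toFinite _)).preimage (isOpenMap_eval 0)
    · intro j hj
      simp only [Set.mem_ofPred_eq, map_mul, map_add, map_sub, MvPolynomial.eval_X,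
        MvPolynomial.eval_C, mul_ne_zero_iff] at hj
      obtain ⟨h0, h1⟩ := hj
      have hsqrt : ∀ z : ℂ, z ≠ 0 → ∃ b : ℂ, b ≠ 0 ∧ b ^ 2 = z := by
        intro z hz
        obtain ⟨b, hb⟩ := IsAlgClosed.exists_pow_nat_eq z two_pos
        exact ⟨b, fun h => hz (by rw [← hb, h]; ring), hb⟩
      refine BKM.isFiniteGapJet_of_speed hm₁ lam k j h0 (fun _ => hsqrt _ h0)
        fun l hl _ β γ => ?_
      rw [← hB l hl] at h1
      obtain ⟨y, hy⟩ := BKM.exists_quadratic_ne_zero h1 β γ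
      exact ⟨y, hsqrt _ hy⟩
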